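/- Let $\mathcal B=\mathbb C[[t_0,t_1,t_2,\dots]]$, let $x=t_0$, and write $\mathbf t\pm[z^{-1}]:=\bigl(t_k\pm (2k-1)!!\,z^{-2k-1}\bigr)_{k\ge 0}$ with $(-1)!!=1$, and $\vartheta(z;\mathbf t):=\sum_{j\ge 0}t_j\,\dfrac{z^{2j+1}}{(2j+1)!!}$. Let $\tau\in\mathcal B$, $\tau\neq 0$, be a KdV tau-function, that is, suppose that $$\mathop{\mathrm{res}}_{z=\infty}\ \tau(\mathbf t-[z^{-1}])\,\tau(\widetilde{\mathbf t}+[z^{-1}])\,\exp\Bigl(\sum_{j\ge 0}\frac{t_j-\widetilde t_j}{(2j+1)!!}\,z^{2j+1}\Bigr)\,z^{2p}\,dz=0\qquad\text{for all } p=0,1,2,\dots,$$ identically in the independent families of variables $\mathbf t,\widetilde{\mathbf t}$, where the residue is minus the coefficient of $z^{-1}$ in the formal expansion at $z=\infty$. Define the wave functions $$\psi(z;\mathbf t)=\frac{\tau(\mathbf t-[z^{-1}])}{\tau(\mathbf t)}\,e^{\vartheta(z;\mathbf t)},\qquad \psi^*(z;\mathbf t)=\psi(-z;\mathbf t)=\frac{\tau(\mathbf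 t+[z^{-1}])}{\tau(\mathbf t)}\,e^{-\vartheta(z;\mathbf t)},$$ and the two-point functions $$\langle\langle\tau_i\tau_j\rangle\rangle:=\frac{\partial^2\log\tau}{\partial t_i\,\partial t_j}=\frac{\partial}{\partial t_i}\Bigl(\frac{1}{\tau}\frac{\partial\tau}{\partial t_j}\Bigr)\in\operatorname{Frac}(\mathcal B).$$ Then, as formal power series in $z^{-1}$ with coefficients in $\operatorname{Frac}(\mathcal B)$, $$1+\sum_{j=0}^\infty\frac{(2j+1)!!}{z^{2j+2}}\,\langle\langle\tau_0\tau_j\rangle\rangle=\psi(z;\mathbf t)\,\psi^*(z;\mathbf t).$$ Moreover, let $L=\partial_x^2+2u$ with $u=\partial_x^2\log\tau=\langle\langle\tau_0\tau_0\rangle\rangle$. In the ring of formal pseudo-differential operators $\sum_{n\le N}a_n\partial_x^n$, $a_n\in\operatorname{Frac}(\mathcal B)$, there is exactly one operator $L^{1/2}$ of the form $\partial_x+q_0+q_1\partial_x^{-1}+\cdots$ with $(L^{1/2})^2=L$, and with $L^{(2j+1)/2}:=(L^{1/2})^{2j+1}$ and $\mathrm{Res}_\partial$ denoting the coefficient of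 $\partial_x^{-1}$ (coefficients written on the left), $$\langle\langle\tau_0\tau_j\rangle\rangle=\frac{1}{(2j+1)!!}\,\mathrm{Res}_{\partial}\,L^{\frac{2j+1}{2}}\qquad\text{for all } j\ge 0.$$ -/

import Mathlib

noncomputable section

/-! ### Derivations of fraction fields -/

/-- The ring homomorphism `f ↦ f + ε D f` from a domain `A` to the dual numbers over `Frac A`. -/
def dualNumberHom {R A : Type*} [CommRing R] [CommRing A] [IsDomain A] [Algebra R A]
    (D : Derivation R A A) :
    A →+* TrivSqZeroExt (FractionRing A) (FractionRing A) where
  toFun f := TrivSqZeroExt.inl (algebraMap A (FractionRing A) f) +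
    TrivSqZeroExt.inr (algebraMap A (FractionRing A) (D f))
  map_one' := by ext <;> simp
  map_zero' := by ext <;> simp
  map_add' f g := by ext <;> simp [Algebra.smul_def]
  map_mul' f g := by
    ext
    · simp
    · simp only [map_mul, Derivation.leibniz, smul_eq_mul, map_add, TrivSqZeroExt.snd_add,
        TrivSqZeroExt.snd_inl, TrivSqZeroExt.snd_inr, TrivSqZeroExt.snd_mul,
        TrivSqZeroExt.fst_add, TrivSqZeroExt.fst_inl, TrivSqZeroExt.fst_inr,
        MulOpposite.smul_eq_mul_unop, MulOpposite.unop_op]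
      ring

theorem isUnit_dualNumberHom {R A : Type*} [CommRing R] [CommRing A] [IsDomain A] [Algebra R A]
    (D : Derivation R A A) (f : nonZeroDivisors A) : IsUnit (dualNumberHom D f) := by
  rw [TrivSqZeroExt.isUnit_iff_isUnit_fst]
  simp [dualNumberHom]

/-- The extension of `dualNumberHom` to the fraction field. -/
def dualNumberLift {R A : Type*} [CommRing R] [CommRing A] [IsDomain A] [Algebra R A]
    (D : Derivation R A A) :
    FractionRing A →+* TrivSqZeroExt (FractionRing A) (FractionRing A) :=
  IsLocalization.lift (M := nonZeroDivisors A) (isUnit_dualNumberHom D)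

theorem dualNumberLift_algebraMap {R A : Type*} [CommRing R] [CommRing A] [IsDomain A]
    [Algebra R A] (D : Derivation R A A) (f : A) :
    dualNumberLift D (algebraMap A (FractionRing A) f) = dualNumberHom D f :=
  IsLocalization.lift_eq _ f

theorem fst_dualNumberLift {R A : Type*} [CommRing R] [CommRing A] [IsDomain A]
    [Algebra R A] (D : Derivation R A A) (x : FractionRing A) :
    (dualNumberLift D x).fst = x := by
  have h : ((TrivSqZeroExt.fstHom (FractionRing A) (FractionRing A)
      (FractionRing A)).toRingHom.comp (dualNumberLift D)) = RingHom.id _ := by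
    refine IsLocalization.ringHom_ext (nonZeroDivisors A) ?_
    ext f
    simp [dualNumberLift_algebraMap, dualNumberHom]
  exact congrArg (fun g : FractionRing A →+* FractionRing A => g x) h

/-- The unique extension of a derivation of a domain to its fraction field
(the quotient rule). -/
def fractionDerivation {R A : Type*} [CommRing R] [CommRing A] [IsDomain A] [Algebra R A]
    (D : Derivation R A A) : Derivation R (FractionRing A) (FractionRing A) where
  toFun x := (dualNumberLift D x).snd
  map_add' x y := by simp
  map_smul' r x := by
    have h : dualNumberLift D (algebraMap R (FractionRing A) r) =
        TrivSqZeroExt.inl (algebraMap R (FractionRing A) r) := by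
      rw [IsScalarTower.algebraMap_apply R A (FractionRing A), dualNumberLift_algebraMap]
      ext <;> simp [dualNumberHom]
    rw [Algebra.smul_def, map_mul, h]
    simp [Algebra.smul_def]
  map_one_eq_zero' := by simp
  leibniz' x y := by
    simp [fst_dualNumberLift, mul_comm]

theorem fractionDerivation_algebraMap {R A : Type*} [CommRing R] [CommRing A] [IsDomain A]
    [Algebra R A] (D : Derivation R A A) (f : A) :
    fractionDerivation D (algebraMap A (FractionRing A) f) =
      algebraMap A (FractionRing A) (D f) := by
  change (dualNumberLift D (algebraMap A (FractionRing A) f)).snd = _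
  rw [dualNumberLift_algebraMap]
  exact zero_add _

/-! ### Formal pseudo-differential operators -/

/-- Formal pseudo-differential operators `∑_{n ≤ N} aₙ ∂ⁿ` over a differential ring `(F, δ)`,
where `∂` stands for `δ`; `coeff n = aₙ` is the coefficient (written on the left) of `∂ⁿ`. -/
@[ext]
structure PseudoDiffOp {R F : Type*} [CommRing R] [CommRing F] [Algebra R F]
    (δ : Derivation R F F) where
  coeff : ℤ → F
  bounded : ∃ N : ℤ, ∀ n : ℤ, N < n → coeff n = 0

namespace PseudoDiffOp

variable {R F : Type*} [CommRing R] [CommRing F] [Algebra R F] {δ : Derivation R F F}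

instance : One (PseudoDiffOp δ) where
  one := ⟨fun n => if n = 0 then 1 else 0, 0, fun _ hn => if_neg hn.ne'⟩

/-- Composition, determined by `∂ⁱ ∘ b = ∑_{k ≥ 0} (i choose k) δᵏ(b) ∂ⁱ⁻ᵏ` for all `i ∈ ℤ`. The
coefficient of `∂ᵐ` in `(∑ aᵢ ∂ⁱ) (∑ bₗ ∂ˡ)` is a sum of terms with `i + l - k = m`,
only finitely many of which are nonzero. -/
instance : Mul (PseudoDiffOp δ) where
  mul P Q :=
    ⟨fun m => ∑ᶠ p : ℤ × ℕ,
        (Ring.choose p.1 p.2 : ℤ) • (P.coeff p.1 * (⇑δ)^[p.2] (Q.coeff (m - p.1 + p.2))), by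
      obtain ⟨M, hM⟩ := P.bounded
      obtain ⟨N, hN⟩ := Q.bounded
      refine ⟨M + N, fun m hm => ?_⟩
      rw [← finsum_zero (α := ℤ × ℕ)]
      refine finsum_congr fun p => ?_
      by_cases h : M < p.1
      · simp [hM _ h]
      · have h2 : N < m - p.1 + p.2 := by omega
        have h3 : ∀ n : ℕ, (⇑δ)^[n] 0 = 0 := fun n => Function.iterate_fixed (map_zero δ) n
        simp [hN _ h2, h3]⟩

/-- Powers `Pⁿ`. -/
def npow (P : PseudoDiffOp δ) (n : ℕ) : PseudoDiffOp δ := npowRec n P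

/-- The residue `Res_∂`: the coefficient of `∂⁻¹`. -/
def residue (P : PseudoDiffOp δ) : F := P.coeff (-1)

/-- The second order differential operator `∂² + v`. -/
def schrodinger (δ : Derivation R F F) (v : F) : PseudoDiffOp δ where
  coeff n := if n = 2 then 1 else if n = 0 then v else 0
  bounded := ⟨2, fun n hn => by
    rw [if_neg (by omega), if_neg (by omega)]⟩

/-- `Q = L^{1/2}`: the operator `Q` has the form `∂ + q₀ + q₁ ∂⁻¹ + ⋯` and `Q² = L`. -/
def IsSqrt (Q L : PseudoDiffOp δ) : Prop :=
  Q.coeff 1 = 1 ∧ (∀ n : ℤ, 1 < n → Q.coeff n = 0) ∧ Q * Q = L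

end PseudoDiffOp

namespace KdV

/-! ### Formal series

Throughout, `w = z⁻¹` is the local parameter at `z = ∞`. A formal Laurent series in `z⁻¹` is an
element of `LaurentSeries ℂ`, the coefficient of `zⁿ` being the coefficient at `-n`. -/

/-- The Bosonic Fock space `ℂ[[t₀, t₁, t₂, …]]`. -/
abbrev Fock : Type := MvPowerSeries ℕ ℂ

instance {σ F : Type} [Field F] : IsDomain (MvPowerSeries σ F) :=
  NoZeroDivisors.to_isDomain _

/-- The field of fractions of the Bosonic Fock space. -/
abbrev FockField : Type := FractionRing Fock

/-- The monomial `zⁿ`, as a Laurent series in `z⁻¹`. -/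
def zPow (n : ℤ) : LaurentSeries ℂ := HahnSeries.single (-n) 1

/-- The formal residue at `z = ∞` of `f(z) dz`: minus the coefficient of `z⁻¹`. -/
def residueAtInfinity (f : LaurentSeries ℂ) : ℂ := -f.coeff 1

/-- Power series in `w = z⁻¹` whose coefficients are power series in the variables `σ`, regarded
as power series in the variables `σ` whose coefficients are Laurent series in `z⁻¹`. -/
def toLaurent {σ : Type} (f : PowerSeries (MvPowerSeries σ ℂ)) :
    MvPowerSeries σ (LaurentSeries ℂ) :=
  fun α => HahnSeries.ofPowerSeries ℤ ℂ
    (PowerSeries.mk fun m => MvPowerSeries.coeff α (PowerSeries.coeff m f))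

/-- The shifted time `t_k + ε (2k-1)!! w^(2k+1)`, in `ℂ[[t, w]]`; here the variables
`σ` contain the times `t_k = s k`, and `none` is the index of `w = z⁻¹`. For `k = 0` the double
factorial is `(-1)!! = 1`. -/
def shiftedTime {σ : Type} (ε : ℂ) (s : ℕ → σ) (k : ℕ) : MvPowerSeries (Option σ) ℂ :=
  MvPowerSeries.X (some (s k)) +
    MvPowerSeries.C (ε * ((2 * k - 1).doubleFactorial : ℂ)) *
      MvPowerSeries.X none ^ (2 * k + 1)

/-- `τ(t + ε [z⁻¹])`, as a power series in `z⁻¹` over the power series in the variables `σ`, where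
`t_k = s k` and `t + ε [z⁻¹] = (t_k + ε (2k-1)!! z^(-2k-1))_{k ≥ 0}`. -/
def shift {σ : Type} (ε : ℂ) (s : ℕ → σ) (τ : Fock) : PowerSeries (MvPowerSeries σ ℂ) :=
  MvPowerSeries.optionEquivLeft σ ℂ (MvPowerSeries.subst (shiftedTime ε s) τ)

/-- The phase `ϑ(z; t) = ∑_{j ≥ 0} t_j z^{2j+1} / (2j+1)!!`, where `t_j = s j`. -/
def phase {σ : Type} (s : ℕ → σ) : MvPowerSeries σ (LaurentSeries ℂ) :=
  fun α => ∑ᶠ j : ℕ, MvPowerSeries.coeff α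
    (MvPowerSeries.C (HahnSeries.C ((2 * j + 1).doubleFactorial : ℂ)⁻¹ * zPow (2 * j + 1)) *
      MvPowerSeries.X (s j))

/-- The exponential `e^φ = ∑ φⁿ / n!` of a power series `φ` without constant term. -/
def expSeries {σ : Type} (φ : MvPowerSeries σ (LaurentSeries ℂ)) :
    MvPowerSeries σ (LaurentSeries ℂ) :=
  (PowerSeries.exp (LaurentSeries ℂ)).subst φ

/-! ### Tau-functions -/

/-- The Hirota bilinear identities of the KdV hierarchy: for all `p ≥ 0`, the residue at `z = ∞` of
`τ(t - [z⁻¹]) τ(t' + [z⁻¹]) exp (∑_{j ≥ 0} (t_j - t'_j) z^{2j+1} / (2j+1)!!) z^{2p} dz`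
vanishes identically in the independent sets of times `t` (indexed by `Sum.inl`) and `t'`
(indexed by `Sum.inr`). -/
def IsTauFunction (τ : Fock) : Prop :=
  ∀ (p : ℕ) (α : ℕ ⊕ ℕ →₀ ℕ),
    residueAtInfinity (MvPowerSeries.coeff α
      (toLaurent (shift (-1) Sum.inl τ) * toLaurent (shift 1 Sum.inr τ) *
        expSeries (phase Sum.inl - phase Sum.inr) * MvPowerSeries.C (zPow (2 * p)))) = 0

/-- The partial derivative `∂/∂t_k` on the fraction field of the Fock space; `x = t₀`. -/
def timeDerivation (k : ℕ) : Derivation ℂ FockField FockField :=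
  fractionDerivation (MvPowerSeries.pderiv ℂ k)

/-- The one-point function `⟨⟨τ_k⟩⟩ = ∂ log τ / ∂t_k = (∂τ/∂t_k) / τ`. -/
def onePoint (τ : Fock) (k : ℕ) : FockField :=
  timeDerivation k (algebraMap Fock FockField τ) / algebraMap Fock FockField τ

/-- The two-point function `⟨⟨τ_i τ_j⟩⟩ = ∂² log τ / ∂t_i ∂t_j`. -/
def twoPoint (τ : Fock) (i j : ℕ) : FockField :=
  timeDerivation i (onePoint τ j)

/-- The Lax operator `L = ∂ₓ² + 2u`, where `u = ∂ₓ² log τ` and `x = t₀`. -/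
def lax (τ : Fock) : PseudoDiffOp (timeDerivation 0) :=
  PseudoDiffOp.schrodinger (timeDerivation 0) (2 * twoPoint τ 0 0)

/-! ### Wave functions -/

/-- The field in which the wave functions live: the fraction field of the power series in the times
over the Laurent series in `z⁻¹`. -/
abbrev WaveField : Type := FractionRing (MvPowerSeries ℕ (LaurentSeries ℂ))

/-- The inclusion of power series in the times over Laurent series in `z⁻¹`. -/
abbrev toWave (f : MvPowerSeries ℕ (LaurentSeries ℂ)) : WaveField :=
  algebraMap (MvPowerSeries ℕ (LaurentSeries ℂ)) WaveField f

/-- A power series in the times, as an element of the field of the wave functions. -/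
abbrev timesToWave (f : Fock) : WaveField := toWave (toLaurent (PowerSeries.C f))

/-- The wave function `ψ(z; t) = τ(t - [z⁻¹]) / τ(t) · e^{ϑ(z; t)}`. -/
def waveFunction (τ : Fock) : WaveField :=
  toWave (toLaurent (shift (-1) id τ)) / timesToWave τ * toWave (expSeries (phase id))

/-- The dual wave function `ψ*(z; t) = ψ(-z; t) = τ(t + [z⁻¹]) / τ(t) · e^{-ϑ(z; t)}`. -/
def dualWaveFunction (τ : Fock) : WaveField :=
  toWave (toLaurent (shift 1 id τ)) / timesToWave τ * toWave (expSeries (-phase id))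

/-- `x = r`, where `x` lies in the field of the wave functions and `r` is a power series in
`w = z⁻¹` over the fraction field of the Fock space: `x` and `r` are one and the same fraction
`f / d` with `f` a power series in `z⁻¹` over the Fock space and `d ≠ 0` in the Fock space. -/
def EqPowerSeries (x : WaveField) (r : PowerSeries FockField) : Prop :=
  ∃ (d : Fock) (f : PowerSeries Fock), d ≠ 0 ∧
    x = toWave (toLaurent f) / timesToWave d ∧
    r = PowerSeries.C (algebraMap Fock FockField d)⁻¹ *
      PowerSeries.map (algebraMap Fock FockField) f

/-- The generating series `∑_{j ≥ 0} (2j+1)!! / z^{2j+2} ⟨⟨τ₀ τ_j⟩⟩`, a power series in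
`w = z⁻¹`. -/
def twoPointSeries (τ : Fock) : PowerSeries FockField :=
  PowerSeries.mk fun n => ∑ᶠ j : ℕ, PowerSeries.coeff n
    (PowerSeries.C (((2 * j + 1).doubleFactorial : FockField) * twoPoint τ 0 j) *
      PowerSeries.X ^ (2 * j + 2))

end KdV

end

/-!
The proof extracts everything from the Hirota identities at coinciding times `t' = t`, after
differentiating them in the first set of times (`hirotaCoeff_eq_zero`, `hirotaCoeff_pderiv`,
`isOrthogonal_shift`).

*Two-point functions.* Differentiate the identity with `p = 0` once in `t_j` and set `t' = t`. If the
derivative falls on `τ(t - [z⁻¹])`, then only the terms of order `z⁰` and `z⁻¹` matter, and the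
coefficient of `z⁻¹` is `-τ² ⟨⟨τ₀ τ_j⟩⟩`; if it falls on the exponential, it produces the factor
`z^{2j+1} / (2j+1)!!` and the coefficient of `z^{-2j-2}` in `τ(t - [z⁻¹]) τ(t + [z⁻¹]) = τ² ψ ψ*`.
Thus `(2j+1)!! ⟨⟨τ₀ τ_j⟩⟩` is the coefficient of `z^{-2j-2}` in `ψ ψ*`
(`hirotaCoeff_eq_twoPoint`). The coefficients of odd powers of `z` vanish by the undifferentiated
identities.

*Square root of `L`.* Write `ψ = W e^ϑ` with `W = τ(t - [z⁻¹]) / τ(t)`, and read `W` as the symbol of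
a pseudo-differential operator, so that `P ψ` corresponds to the product `P W` of operators and the
multiplication by `z` to the composition with `∂` on the right. The identities differentiated in
`x = t₀` say that `∂ᵃ W` and `z² ∂ᵃ W`, `a ≥ 0`, are orthogonal to `ψ*` for the residue pairing. Now
`L W - z² W` has negative order, and a symbol `A ≠ 0` of order `-m < 0` has a nonzero pairing at
`∂^{m-1} A`; so `L ψ = z² ψ` (`IsOrthogonal.schrodinger_mul`, `lax_mul`). Since `P ↦ P W` is
bijective, `Q W = z W` defines an operator `Q`, and `Q² = L` because `Q² W = z² W`. Conversely, every
square root `Q` satisfies `Q W = z W` (`sqrt_mul_eq_shift`), which gives uniqueness.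

*Residues.* For `i ∈ ℤ` the pairing of `∂ⁱ W` with `ψ*` is `0` for `i ≥ 0` by orthogonality, `1` for
`i = -1`, and `0` for `i < -1` by order. Hence the pairing of `P W` is the residue of `P`
(`IsOrthogonal.residuePairing_mul`). For `P = Qⁿ` one has `P W = zⁿ W`, so the residue of `Qⁿ` is the
coefficient of `z^{-n-1}` in `ψ ψ*` (`residue_npow`).

The composition of pseudo-differential operators is associative because `∂ⁱ (Q A) = (∂ⁱ Q) A`, which
follows for all `i ∈ ℤ` from the case `i = 1`, as left composition with `∂` is injective.
-/

noncomputable section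

/-! ### The ring of pseudo-differential operators -/

namespace PseudoDiffOp

variable {R F : Type*} [CommRing R] [CommRing F] [Algebra R F] {δ : Derivation R F F}

instance : Zero (PseudoDiffOp δ) := ⟨⟨fun _ => 0, 0, fun _ _ => rfl⟩⟩

instance : Add (PseudoDiffOp δ) where
  add P Q := ⟨fun n => P.coeff n + Q.coeff n, by
    obtain ⟨M, hM⟩ := P.bounded
    obtain ⟨N, hN⟩ := Q.bounded
    exact ⟨max M N, fun n hn => by
      rw [hM n (lt_of_le_of_lt (le_max_left _ _) hn),
        hN n (lt_of_le_of_lt (le_max_right _ _) hn), add_zero]⟩⟩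

instance : Neg (PseudoDiffOp δ) where
  neg P := ⟨fun n => -P.coeff n, by
    obtain ⟨M, hM⟩ := P.bounded
    exact ⟨M, fun n hn => by rw [hM n hn, neg_zero]⟩⟩

instance : SMul F (PseudoDiffOp δ) where
  smul a P := ⟨fun n => a * P.coeff n, by
    obtain ⟨M, hM⟩ := P.bounded
    exact ⟨M, fun n hn => by rw [hM n hn, mul_zero]⟩⟩

@[simp] theorem coeff_zero (n : ℤ) : (0 : PseudoDiffOp δ).coeff n = 0 := rfl
@[simp] theorem coeff_add (P Q : PseudoDiffOp δ) (n : ℤ) :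
    (P + Q).coeff n = P.coeff n + Q.coeff n := rfl
@[simp] theorem coeff_neg (P : PseudoDiffOp δ) (n : ℤ) : (-P).coeff n = -P.coeff n := rfl
@[simp] theorem coeff_smul (a : F) (P : PseudoDiffOp δ) (n : ℤ) :
    (a • P).coeff n = a * P.coeff n := rfl

instance : AddCommGroup (PseudoDiffOp δ) :=
  { AddGroup.ofLeftAxioms (G := PseudoDiffOp δ)
      (fun _ _ _ => by ext; simp [add_assoc]) (fun _ => by ext; simp)
      (fun _ => by ext; simp) with
    add_comm := fun _ _ => by ext; simp [add_comm] }

@[simp] theorem coeff_sub (P Q : PseudoDiffOp δ) (n : ℤ) :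
    (P - Q).coeff n = P.coeff n - Q.coeff n := by
  rw [sub_eq_add_neg, coeff_add, coeff_neg, sub_eq_add_neg]

theorem iterate_derivation_zero (k : ℕ) : (⇑δ)^[k] 0 = 0 :=
  Function.iterate_fixed (map_zero δ) k

theorem iterate_derivation_add (k : ℕ) (a b : F) :
    (⇑δ)^[k] (a + b) = (⇑δ)^[k] a + (⇑δ)^[k] b := by
  induction k generalizing a b with
  | zero => rfl
  | succ k ih => simp only [Function.iterate_succ_apply, map_add, ih]

/-- The operator `∂ⁱ ∘ A`, for `i ∈ ℤ`. -/
def dpow (i : ℤ) (A : PseudoDiffOp δ) : PseudoDiffOp δ where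
  coeff m := ∑ᶠ k : ℕ, (Ring.choose i k : ℤ) • (⇑δ)^[k] (A.coeff (m - i + k))
  bounded := by
    obtain ⟨N, hN⟩ := A.bounded
    refine ⟨N + i, fun m hm => ?_⟩
    rw [← finsum_zero (α := ℕ)]
    refine finsum_congr fun k => ?_
    rw [hN _ (by omega), iterate_derivation_zero, smul_zero]

theorem coeff_dpow_eq_sum (i m : ℤ) {A : PseudoDiffOp δ} {N : ℤ}
    (hA : ∀ n, N < n → A.coeff n = 0) {K : ℕ} (hK : N - m + i < K) :
    (dpow i A).coeff m =
      ∑ k ∈ Finset.range K, (Ring.choose i k : ℤ) • (⇑δ)^[k] (A.coeff (m - i + k)) := by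
  refine finsum_eq_sum_of_support_subset _ fun k hk => ?_
  by_contra hk'
  rw [Finset.mem_coe, Finset.mem_range, not_lt] at hk'
  refine hk ?_
  beta_reduce
  rw [hA _ (by omega), iterate_derivation_zero, smul_zero]

theorem coeff_dpow_eq_zero (i m : ℤ) {A : PseudoDiffOp δ} {N : ℤ}
    (hA : ∀ n, N < n → A.coeff n = 0) (hm : N + i < m) : (dpow i A).coeff m = 0 := by
  rw [coeff_dpow_eq_sum i m hA (K := 0) (by push_cast; omega), Finset.sum_range_zero]

theorem coeff_dpow_top (i : ℤ) {A : PseudoDiffOp δ} {N : ℤ}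
    (hA : ∀ n, N < n → A.coeff n = 0) : (dpow i A).coeff (N + i) = A.coeff N := by
  rw [coeff_dpow_eq_sum i _ hA (K := 1) (by push_cast; omega)]
  simp

theorem coeff_mul_eq_sum (m : ℤ) {P A : PseudoDiffOp δ} {M N a b : ℤ}
    (hP : ∀ n, M < n → P.coeff n = 0) (hA : ∀ n, N < n → A.coeff n = 0)
    (ha : a ≤ m - N) (hb : M ≤ b) :
    (P * A).coeff m = ∑ i ∈ Finset.Icc a b, P.coeff i * (dpow i A).coeff m := by
  have h0 : (P * A).coeff m = ∑ᶠ p : ℤ × ℕ,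
      (Ring.choose p.1 p.2 : ℤ) • (P.coeff p.1 * (⇑δ)^[p.2] (A.coeff (m - p.1 + p.2))) := rfl
  obtain ⟨K, hK⟩ : ∃ K : ℕ, N - m + b < K := ⟨(N - m + b).toNat + 1, by omega⟩
  rw [h0, finsum_eq_sum_of_support_subset (s := Finset.Icc a b ×ˢ Finset.range K)]
  · rw [Finset.sum_product]
    refine Finset.sum_congr rfl fun i hi => ?_
    rw [Finset.mem_Icc] at hi
    rw [coeff_dpow_eq_sum i m hA (K := K) (by omega), Finset.mul_sum]
    exact Finset.sum_congr rfl fun k _ => (mul_smul_comm _ _ _).symm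
  · rintro ⟨i, k⟩ h
    rw [Function.mem_support] at h
    by_contra h'
    apply h
    simp only [Finset.coe_product, Set.mem_prod, Finset.mem_coe, Finset.mem_Icc,
      Finset.mem_range, not_and_or, not_le, not_lt] at h'
    by_cases hi : M < i
    · simp [hP _ hi]
    · rw [hA _ (by omega), iterate_derivation_zero, mul_zero, smul_zero]

theorem coeff_mul_eq_zero {P A : PseudoDiffOp δ} {M N m : ℤ}
    (hP : ∀ n, M < n → P.coeff n = 0) (hA : ∀ n, N < n → A.coeff n = 0) (hm : M + N < m) :
    (P * A).coeff m = 0 := by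
  rw [coeff_mul_eq_sum m hP hA le_rfl le_rfl, Finset.Icc_eq_empty (by omega), Finset.sum_empty]

/-- The leading coefficient of a product. -/
theorem coeff_mul_top {P A : PseudoDiffOp δ} {M N : ℤ}
    (hP : ∀ n, M < n → P.coeff n = 0) (hA : ∀ n, N < n → A.coeff n = 0) :
    (P * A).coeff (M + N) = P.coeff M * A.coeff N := by
  rw [coeff_mul_eq_sum (M + N) hP hA le_rfl le_rfl, add_sub_cancel_right, Finset.Icc_self,
    Finset.sum_singleton, add_comm, coeff_dpow_top M hA]

theorem exists_common_bound (P Q : PseudoDiffOp δ) :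
    ∃ N : ℤ, (∀ n, N < n → P.coeff n = 0) ∧ ∀ n, N < n → Q.coeff n = 0 := by
  obtain ⟨M, hM⟩ := P.bounded
  obtain ⟨N, hN⟩ := Q.bounded
  exact ⟨max M N, fun n hn => hM n (lt_of_le_of_lt (le_max_left _ _) hn),
    fun n hn => hN n (lt_of_le_of_lt (le_max_right _ _) hn)⟩

theorem exists_top {A : PseudoDiffOp δ} (hA : A ≠ 0) :
    ∃ N : ℤ, A.coeff N ≠ 0 ∧ ∀ n, N < n → A.coeff n = 0 := by
  obtain ⟨M, hM⟩ := A.bounded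
  have hne : ∃ n, A.coeff n ≠ 0 := by
    by_contra! h
    exact hA (by ext n; exact h n)
  obtain ⟨N, hN, hmax⟩ := Int.exists_greatest_of_bdd (P := fun n => A.coeff n ≠ 0)
    ⟨M, fun n hn => not_lt.1 fun h => hn (hM n h)⟩ hne
  exact ⟨N, hN, fun n hn => by_contra fun h => absurd (hmax n h) (not_le.2 hn)⟩

theorem dpow_add (i : ℤ) (A B : PseudoDiffOp δ) : dpow i (A + B) = dpow i A + dpow i B := by
  obtain ⟨N, hA, hB⟩ := exists_common_bound A B
  ext m
  obtain ⟨K, hK⟩ : ∃ K : ℕ, N - m + i < K := ⟨(N - m + i).toNat + 1, by omega⟩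
  rw [coeff_add, coeff_dpow_eq_sum i m hA hK, coeff_dpow_eq_sum i m hB hK,
    coeff_dpow_eq_sum i m (A := A + B) (N := N) (fun n hn => by simp [hA n hn, hB n hn]) hK,
    ← Finset.sum_add_distrib]
  refine Finset.sum_congr rfl fun k _ => ?_
  rw [coeff_add, iterate_derivation_add, smul_add]

theorem mul_add' (P A B : PseudoDiffOp δ) : P * (A + B) = P * A + P * B := by
  obtain ⟨N, hA, hB⟩ := exists_common_bound A B
  obtain ⟨M, hP⟩ := P.bounded
  ext m
  rw [coeff_add, coeff_mul_eq_sum m hP hA le_rfl le_rfl, coeff_mul_eq_sum m hP hB le_rfl le_rfl,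
    coeff_mul_eq_sum m hP (A := A + B) (N := N) (fun n hn => by simp [hA n hn, hB n hn])
      le_rfl le_rfl, ← Finset.sum_add_distrib]
  refine Finset.sum_congr rfl fun k _ => ?_
  rw [dpow_add, coeff_add, mul_add]

theorem add_mul' (P Q A : PseudoDiffOp δ) : (P + Q) * A = P * A + Q * A := by
  obtain ⟨M, hP, hQ⟩ := exists_common_bound P Q
  obtain ⟨N, hA⟩ := A.bounded
  ext m
  rw [coeff_add, coeff_mul_eq_sum m hP hA le_rfl le_rfl, coeff_mul_eq_sum m hQ hA le_rfl le_rfl,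
    coeff_mul_eq_sum m (P := P + Q) (M := M) (fun n hn => by simp [hP n hn, hQ n hn]) hA
      le_rfl le_rfl, ← Finset.sum_add_distrib]
  refine Finset.sum_congr rfl fun k _ => ?_
  rw [coeff_add, add_mul]

instance : Distrib (PseudoDiffOp δ) :=
  { (inferInstance : AddCommGroup (PseudoDiffOp δ)),
    (inferInstance : Mul (PseudoDiffOp δ)) with
    left_distrib := mul_add'
    right_distrib := add_mul' }

theorem mul_sub' (P A B : PseudoDiffOp δ) : P * (A - B) = P * A - P * B :=
  eq_sub_of_add_eq (by rw [← mul_add, sub_add_cancel])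

theorem sub_mul' (P Q A : PseudoDiffOp δ) : (P - Q) * A = P * A - Q * A :=
  eq_sub_of_add_eq (by rw [← add_mul, sub_add_cancel])

theorem dpow_zero (A : PseudoDiffOp δ) : dpow 0 A = A := by
  obtain ⟨N, hA⟩ := A.bounded
  ext m
  obtain ⟨K, hK⟩ : ∃ K : ℕ, N - m < K := ⟨(N - m).toNat + 1, by omega⟩
  rw [coeff_dpow_eq_sum 0 m hA (K := K + 1) (by push_cast; omega), Finset.sum_range_succ',
    Finset.sum_eq_zero]
  · simp
  · intro k _
    rw [Ring.choose_zero_succ, zero_smul]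

/-- The operator `∂ ∘ A`. -/
def deriv (A : PseudoDiffOp δ) : PseudoDiffOp δ where
  coeff n := δ (A.coeff n) + A.coeff (n - 1)
  bounded := by
    obtain ⟨N, hN⟩ := A.bounded
    exact ⟨N + 1, fun n hn => by rw [hN n (by omega), hN _ (by omega), map_zero, add_zero]⟩

@[simp] theorem coeff_deriv (A : PseudoDiffOp δ) (n : ℤ) :
    (deriv A).coeff n = δ (A.coeff n) + A.coeff (n - 1) := rfl

theorem deriv_add (A B : PseudoDiffOp δ) : deriv (A + B) = deriv A + deriv B := by
  ext n; simp; ring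

theorem deriv_sub (A B : PseudoDiffOp δ) : deriv (A - B) = deriv A - deriv B := by
  ext n; simp; ring

theorem deriv_smul (a : F) (A : PseudoDiffOp δ) : deriv (a • A) = δ a • A + a • deriv A := by
  ext n; simp; ring

theorem coeff_deriv_top {A : PseudoDiffOp δ} {N : ℤ} (hA : ∀ n, N < n → A.coeff n = 0) :
    (deriv A).coeff (N + 1) = A.coeff N := by
  rw [coeff_deriv, hA _ (by omega), map_zero, zero_add, add_sub_cancel_right]

theorem coeff_deriv_eq_zero {A : PseudoDiffOp δ} {N : ℤ} (hA : ∀ n, N < n → A.coeff n = 0)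
    (n : ℤ) (hn : N + 1 < n) : (deriv A).coeff n = 0 := by
  rw [coeff_deriv, hA _ (by omega), hA _ (by omega), map_zero, zero_add]

theorem deriv_injective : Function.Injective (deriv : PseudoDiffOp δ → PseudoDiffOp δ) := by
  intro A B h
  rw [← sub_eq_zero]
  by_contra hne
  obtain ⟨N, h1, h2⟩ := exists_top hne
  refine h1 ?_
  rw [← coeff_deriv_top h2, deriv_sub, h, sub_self, coeff_zero]

/-- Pascal's rule for the generalized binomial coefficients. -/
theorem deriv_dpow (i : ℤ) (A : PseudoDiffOp δ) : deriv (dpow i A) = dpow (i + 1) A := by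
  obtain ⟨N, hA⟩ := A.bounded
  ext m
  obtain ⟨K, hK⟩ : ∃ K : ℕ, N - m + i + 1 < K := ⟨(N - m + i + 1).toNat + 1, by omega⟩
  rw [coeff_deriv, coeff_dpow_eq_sum i m hA (K := K) (by omega),
    coeff_dpow_eq_sum i (m - 1) hA (K := K + 1) (by push_cast; omega),
    coeff_dpow_eq_sum (i + 1) m hA (K := K + 1) (by push_cast; omega),
    Finset.sum_range_succ', Finset.sum_range_succ', map_sum, ← add_assoc,
    ← Finset.sum_add_distrib]
  congr 1
  · refine Finset.sum_congr rfl fun k _ => ?_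
    rw [Ring.choose_succ_succ, add_smul, map_zsmul, ← Function.iterate_succ_apply' (⇑δ)]
    have e1 : m - (i + 1) + ((k + 1 : ℕ) : ℤ) = m - i + k := by push_cast; ring
    have e2 : m - 1 - i + ((k + 1 : ℕ) : ℤ) = m - i + k := by push_cast; ring
    rw [e1, e2]
  · have e : m - 1 - i + ((0 : ℕ) : ℤ) = m - (i + 1) + ((0 : ℕ) : ℤ) := by push_cast; ring
    rw [e, Ring.choose_zero_right, Ring.choose_zero_right]

theorem deriv_mul (P A : PseudoDiffOp δ) : deriv (P * A) = deriv P * A := by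
  obtain ⟨M, hP⟩ := P.bounded
  obtain ⟨N, hA⟩ := A.bounded
  ext m
  rw [coeff_deriv, coeff_mul_eq_sum m hP hA (a := m - 1 - N) (b := M + 1) (by omega) (by omega),
    coeff_mul_eq_sum (m - 1) hP hA (a := m - 1 - N) (b := M + 1) (by omega) (by omega),
    coeff_mul_eq_sum m (coeff_deriv_eq_zero hP) hA (a := m - 1 - N) (b := M + 1 + 1)
      (by omega) (by omega), map_sum, ← Finset.sum_add_distrib]
  have h1 : ∀ i, δ (P.coeff i * (dpow i A).coeff m) + P.coeff i * (dpow i A).coeff (m - 1) =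
      δ (P.coeff i) * (dpow i A).coeff m + P.coeff i * (dpow (i + 1) A).coeff m := by
    intro i
    rw [← deriv_dpow, coeff_deriv, Derivation.leibniz, smul_eq_mul, smul_eq_mul]
    ring
  simp only [h1, coeff_deriv, add_mul, Finset.sum_add_distrib]
  congr 1
  · refine Finset.sum_subset (Finset.Icc_subset_Icc_right (by omega)) fun i hi hi' => ?_
    rw [Finset.mem_Icc] at hi hi'
    rw [hP i (by omega), map_zero, zero_mul]
  · rw [← Finset.sum_subset (s₁ := Finset.Icc (m - 1 - N + 1) (M + 1 + 1))
      (Finset.Icc_subset_Icc_left (by omega))]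
    · rw [← Finset.map_add_right_Icc (m - 1 - N) (M + 1) 1, Finset.sum_map]
      refine Finset.sum_congr rfl fun i _ => ?_
      rw [addRightEmbedding_apply, add_sub_cancel_right]
    · intro i hi hi'
      rw [Finset.mem_Icc] at hi hi'
      rw [coeff_dpow_eq_zero i m hA (by omega), mul_zero]

/-- Associativity with a power of `∂` on the left; for negative `i` it is obtained by cancelling `∂`. -/
theorem dpow_mul (i : ℤ) (P A : PseudoDiffOp δ) : dpow i (P * A) = dpow i P * A := by
  induction i using Int.induction_on with
  | zero => rw [dpow_zero, dpow_zero]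
  | succ i ih => rw [← deriv_dpow, ← deriv_dpow, ih, deriv_mul]
  | pred i ih =>
    apply deriv_injective
    rw [deriv_dpow, deriv_mul, deriv_dpow, sub_add_cancel, ih]

theorem mul_assoc' (P Q A : PseudoDiffOp δ) : P * Q * A = P * (Q * A) := by
  obtain ⟨M, hP⟩ := P.bounded
  obtain ⟨M', hQ⟩ := Q.bounded
  obtain ⟨N, hA⟩ := A.bounded
  ext m
  rw [coeff_mul_eq_sum m hP (fun n hn => coeff_mul_eq_zero hQ hA hn) le_rfl le_rfl,
    coeff_mul_eq_sum m (fun n hn => coeff_mul_eq_zero hP hQ hn) hA le_rfl le_rfl]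
  have h1 : ∀ n ∈ Finset.Icc (m - N) (M + M'), (P * Q).coeff n * (dpow n A).coeff m =
      ∑ i ∈ Finset.Icc (m - (M' + N)) M, P.coeff i * ((dpow i Q).coeff n * (dpow n A).coeff m) := by
    intro n hn
    rw [Finset.mem_Icc] at hn
    rw [coeff_mul_eq_sum n hP hQ (a := m - (M' + N)) (by omega) le_rfl, Finset.sum_mul]
    exact Finset.sum_congr rfl fun i _ => mul_assoc _ _ _
  rw [Finset.sum_congr rfl h1, Finset.sum_comm]
  refine Finset.sum_congr rfl fun i hi => ?_
  rw [Finset.mem_Icc] at hi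
  rw [dpow_mul, coeff_mul_eq_sum m (fun n hn => coeff_dpow_eq_zero i n hQ hn) hA (a := m - N)
    (b := M + M') le_rfl (by omega), Finset.mul_sum]

/-! ### Symbols and square roots -/

/-- Right composition with `∂ⁿ`; on symbols it is multiplication by `zⁿ`. -/
def shift (n : ℤ) (A : PseudoDiffOp δ) : PseudoDiffOp δ where
  coeff m := A.coeff (m - n)
  bounded := by
    obtain ⟨N, hN⟩ := A.bounded
    exact ⟨N + n, fun m hm => hN _ (by omega)⟩

@[simp] theorem coeff_shift (n m : ℤ) (A : PseudoDiffOp δ) :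
    (shift n A).coeff m = A.coeff (m - n) := rfl

theorem shift_shift (n m : ℤ) (A : PseudoDiffOp δ) : shift n (shift m A) = shift (n + m) A := by
  ext k; simp [sub_sub]

theorem shift_sub (n : ℤ) (A B : PseudoDiffOp δ) : shift n (A - B) = shift n A - shift n B := by
  ext k; simp

theorem mul_shift (P A : PseudoDiffOp δ) (n : ℤ) : P * shift n A = shift n (P * A) := by
  ext m
  change ∑ᶠ p : ℤ × ℕ, _ = ∑ᶠ p : ℤ × ℕ, _
  refine finsum_congr fun p => ?_
  rw [coeff_shift]
  congr 4
  ring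

theorem deriv_shift (A : PseudoDiffOp δ) (n : ℤ) : deriv (shift n A) = shift n (deriv A) := by
  ext m
  simp only [coeff_deriv, coeff_shift]
  congr 2
  ring

theorem one_mul' (A : PseudoDiffOp δ) : 1 * A = A := by
  obtain ⟨N, hA⟩ := A.bounded
  ext m
  have h1 : ∀ n : ℤ, 0 < n → (1 : PseudoDiffOp δ).coeff n = 0 := fun _ hn => if_neg hn.ne'
  rw [coeff_mul_eq_sum m h1 hA (a := min 0 (m - N)) (min_le_right _ _) le_rfl,
    Finset.sum_eq_single 0]
  · rw [dpow_zero]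
    change (if (0 : ℤ) = 0 then (1 : F) else 0) * _ = _
    rw [if_pos rfl, one_mul]
  · intro i _ hi
    change (if i = 0 then (1 : F) else 0) * _ = _
    rw [if_neg hi, zero_mul]
  · intro h
    simp at h

theorem schrodinger_mul (v : F) (A : PseudoDiffOp δ) :
    schrodinger δ v * A = deriv (deriv A) + v • A := by
  obtain ⟨N, hA⟩ := A.bounded
  ext m
  have h1 : ∀ n : ℤ, 2 < n → (schrodinger δ v).coeff n = 0 := fun n hn => by
    simp only [schrodinger]
    rw [if_neg (by omega), if_neg (by omega)]
  have h2 : deriv (deriv A) = dpow 2 A := by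
    rw [← dpow_zero A, deriv_dpow, deriv_dpow]
    norm_num [dpow_zero]
  rw [coeff_mul_eq_sum m h1 hA (a := min 0 (m - N)) (min_le_right _ _) le_rfl, coeff_add,
    coeff_smul, h2, Finset.sum_eq_add (2 : ℤ) 0 (by norm_num)]
  · simp [schrodinger, dpow_zero]
  · intro i _ hi
    simp [schrodinger, hi.1, hi.2]
  · intro h
    simp at h
  · intro h
    simp at h

/-- If the leading coefficient of `W` is `1`, every `V` is of the form `P ∘ W`. -/
theorem exists_mul_eq {W : PseudoDiffOp δ} (h0 : W.coeff 0 = 1)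
    (hW : ∀ n, 0 < n → W.coeff n = 0) (V : PseudoDiffOp δ) (N : ℤ)
    (hV : ∀ n, N < n → V.coeff n = 0) :
    ∃ P : PseudoDiffOp δ, (∀ n, N < n → P.coeff n = 0) ∧ P * W = V := by
  -- The coefficient of `∂^(N-n)` in `P` is determined by the previous ones.
  obtain ⟨p, hp⟩ : ∃ p : ℕ → F, ∀ n, p n = V.coeff (N - n) -
      ∑ k : Fin n, p k * (dpow (N - (k : ℕ)) W).coeff (N - n) := by
    let rec' : ∀ n : ℕ, (∀ k, k < n → F) → F := fun n ih =>
      V.coeff (N - n) - ∑ k : Fin n, ih k k.2 * (dpow (N - (k : ℕ)) W).coeff (N - n)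
    refine ⟨fun n => Nat.strongRec (motive := fun _ => F) rec' n, fun n => ?_⟩
    beta_reduce
    rw [Nat.strongRec_eq]
  let P : PseudoDiffOp δ := ⟨fun m => if m ≤ N then p (N - m).toNat else 0, N, fun n hn =>
    if_neg (by omega)⟩
  have hP : ∀ n, N < n → P.coeff n = 0 := fun n hn => if_neg (by omega)
  refine ⟨P, hP, ?_⟩
  ext m
  rcases lt_or_ge N m with hm | hm
  · rw [hV m hm, coeff_mul_eq_zero hP hW (by omega)]
  obtain ⟨n, rfl⟩ : ∃ n : ℕ, m = N - n := ⟨(N - m).toNat, by omega⟩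
  have hPn : ∀ k : ℕ, P.coeff (N - k) = p k := fun k => by
    change (if N - (k : ℤ) ≤ N then p (N - (N - (k : ℤ))).toNat else 0) = _
    rw [if_pos (by omega)]
    congr 1
    omega
  have hs : ∑ i ∈ Finset.Icc (N - n) N, P.coeff i * (dpow i W).coeff (N - n) =
      ∑ k ∈ Finset.range (n + 1), p k * (dpow (N - (k : ℕ)) W).coeff (N - n) := by
    refine (Finset.sum_bij (fun (k : ℕ) _ => N - (k : ℤ)) ?_ ?_ ?_ ?_).symm
    · intro k hk
      rw [Finset.mem_range] at hk
      rw [Finset.mem_Icc]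
      omega
    · intro k _ k' _ h
      simpa using h
    · intro i hi
      rw [Finset.mem_Icc] at hi
      exact ⟨(N - i).toNat, by rw [Finset.mem_range]; omega, by omega⟩
    · intro k _
      rw [hPn]
  have htop : (dpow (N - (n : ℤ)) W).coeff (N - n) = 1 := by
    have := coeff_dpow_top (N - (n : ℤ)) hW
    rwa [zero_add, h0] at this
  rw [coeff_mul_eq_sum _ hP hW (a := N - n) (by omega) le_rfl, hs, Finset.sum_range_succ, htop,
    mul_one, hp n, Finset.sum_range]
  ring

theorem eq_of_mul_eq {W : PseudoDiffOp δ} (h0 : W.coeff 0 = 1)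
    (hW : ∀ n, 0 < n → W.coeff n = 0) {P Q : PseudoDiffOp δ} (h : P * W = Q * W) : P = Q := by
  rw [← sub_eq_zero]
  by_contra hne
  obtain ⟨N, h1, h2⟩ := exists_top hne
  refine h1 ?_
  have := coeff_mul_top h2 hW
  rwa [sub_mul', h, sub_self, coeff_zero, h0, mul_one, eq_comm] at this

/-- If `L` has the eigenfunction `W` with eigenvalue `z²`, a square root of `L` has the
eigenfunction `W` with eigenvalue `z`: the difference `E = Q W - z W` satisfies `Q E = -z E`, while
the leading coefficients of `Q E` and `z E` agree. -/
theorem sqrt_mul_eq_shift [IsDomain F] [NeZero (2 : F)] {W L Q : PseudoDiffOp δ}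
    (hL : L * W = shift 2 W) (hQ : IsSqrt Q L) : Q * W = shift 1 W := by
  obtain ⟨hQ1, hQ2, hQQ⟩ := hQ
  have key : Q * (Q * W - shift 1 W) = -shift 1 (Q * W - shift 1 W) := by
    rw [mul_sub', ← mul_assoc', hQQ, hL, mul_shift, shift_sub, shift_shift]
    norm_num
  rw [← sub_eq_zero]
  by_contra hne
  obtain ⟨N, h1, h2⟩ := exists_top hne
  have h3 := coeff_mul_top hQ2 h2
  rw [key, coeff_neg, coeff_shift, add_sub_cancel_left, hQ1, one_mul] at h3
  have h4 : (2 : F) * (Q * W - shift 1 W).coeff N = 0 := by linear_combination -h3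
  exact h1 ((mul_eq_zero.1 h4).resolve_left two_ne_zero)

theorem existsUnique_sqrt [IsDomain F] [NeZero (2 : F)] {W L : PseudoDiffOp δ}
    (h0 : W.coeff 0 = 1) (hW : ∀ n, 0 < n → W.coeff n = 0) (hL : L * W = shift 2 W) :
    ∃! Q, IsSqrt Q L := by
  have hsW : ∀ n, 1 < n → (shift 1 W).coeff n = 0 := fun n hn => hW _ (by omega)
  obtain ⟨Q, hQ, hQW⟩ := exists_mul_eq h0 hW (shift 1 W) 1 hsW
  refine ⟨Q, ⟨?_, hQ, ?_⟩, fun Q' hQ' => ?_⟩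
  · have := coeff_mul_top hQ hW
    rw [hQW, h0, mul_one, coeff_shift] at this
    rw [← this, ← h0]
    norm_num
  · apply eq_of_mul_eq h0 hW
    rw [mul_assoc', hQW, mul_shift, hQW, shift_shift, hL]
    norm_num
  · apply eq_of_mul_eq h0 hW
    rw [hQW, sqrt_mul_eq_shift hL hQ']

theorem npow_mul_eq_shift {W Q : PseudoDiffOp δ} (h : Q * W = shift 1 W) (n : ℕ) :
    Q.npow n * W = shift n W := by
  induction n with
  | zero =>
    change 1 * W = _
    rw [one_mul']
    ext m
    simp
  | succ n ih =>
    change Q.npow n * Q * W = _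
    rw [mul_assoc', h, mul_shift, ih, shift_shift, Nat.cast_succ, add_comm]

end PseudoDiffOp

/-! ### The residue pairing of symbols -/

namespace PseudoDiffOp

variable {R F : Type*} [CommRing R] [CommRing F] [Algebra R F] {δ : Derivation R F F}

/-- The coefficient of `z⁻¹` in the (commutative) product of the symbol `∑ aₙ zⁿ` of `A` with the
power series `∑_{k ≥ 0} U_k z⁻ᵏ`. -/
def residuePairing (U : ℕ → F) (A : PseudoDiffOp δ) : F := ∑ᶠ k : ℕ, A.coeff (k - 1) * U k

theorem residuePairing_eq_sum (U : ℕ → F) {A : PseudoDiffOp δ} {N : ℤ}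
    (hA : ∀ n, N < n → A.coeff n = 0) {K : ℕ} (hK : N + 1 < K) :
    residuePairing U A = ∑ k ∈ Finset.range K, A.coeff (k - 1) * U k := by
  refine finsum_eq_sum_of_support_subset _ fun k hk => ?_
  by_contra hk'
  rw [Finset.mem_coe, Finset.mem_range, not_lt] at hk'
  refine hk ?_
  beta_reduce
  rw [hA _ (by omega), zero_mul]

theorem residuePairing_add (U : ℕ → F) (A B : PseudoDiffOp δ) :
    residuePairing U (A + B) = residuePairing U A + residuePairing U B := by
  obtain ⟨N, hA, hB⟩ := exists_common_bound A B
  obtain ⟨K, hK⟩ : ∃ K : ℕ, N + 1 < K := ⟨(N + 1).toNat + 1, by omega⟩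
  rw [residuePairing_eq_sum U hA hK, residuePairing_eq_sum U hB hK,
    residuePairing_eq_sum U (A := A + B) (N := N) (fun n hn => by simp [hA n hn, hB n hn]) hK,
    ← Finset.sum_add_distrib]
  exact Finset.sum_congr rfl fun k _ => by rw [coeff_add, add_mul]

theorem residuePairing_smul (U : ℕ → F) (a : F) (A : PseudoDiffOp δ) :
    residuePairing U (a • A) = a * residuePairing U A := by
  obtain ⟨N, hA⟩ := A.bounded
  obtain ⟨K, hK⟩ : ∃ K : ℕ, N + 1 < K := ⟨(N + 1).toNat + 1, by omega⟩
  rw [residuePairing_eq_sum U hA hK,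
    residuePairing_eq_sum U (A := a • A) (N := N) (fun n hn => by simp [hA n hn]) hK,
    Finset.mul_sum]
  exact Finset.sum_congr rfl fun k _ => by rw [coeff_smul, mul_assoc]

theorem residuePairing_eq_top (U : ℕ → F) {A : PseudoDiffOp δ}
    (hA : ∀ n, -1 < n → A.coeff n = 0) : residuePairing U A = A.coeff (-1) * U 0 := by
  rw [residuePairing_eq_sum U hA (K := 1) (by norm_num), Finset.sum_range_one, Nat.cast_zero,
    zero_sub]

/-- `A` and all its left multiples `∂ᵃ ∘ A`, `a ≥ 0`, are orthogonal to `U` for the residue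
pairing. When `A` is the symbol of a wave function and `U` that of the dual one, this is the
bilinear identity, expanded at coinciding times along `x`. -/
def IsOrthogonal (U : ℕ → F) (A : PseudoDiffOp δ) : Prop :=
  ∀ a : ℕ, residuePairing U (deriv^[a] A) = 0

theorem iterate_deriv_add (a : ℕ) (A B : PseudoDiffOp δ) :
    deriv^[a] (A + B) = deriv^[a] A + deriv^[a] B := by
  induction a generalizing A B with
  | zero => rfl
  | succ a ih => simp only [Function.iterate_succ_apply, deriv_add, ih]

theorem IsOrthogonal.add {U : ℕ → F} {A B : PseudoDiffOp δ} (hA : IsOrthogonal U A)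
    (hB : IsOrthogonal U B) : IsOrthogonal U (A + B) := fun a => by
  rw [iterate_deriv_add, residuePairing_add, hA a, hB a, add_zero]

theorem IsOrthogonal.deriv {U : ℕ → F} {A : PseudoDiffOp δ} (hA : IsOrthogonal U A) :
    IsOrthogonal U (deriv A) := fun a => hA (a + 1)

/-- Orthogonality is `F`-linear although `∂` is not, by the Leibniz rule. -/
theorem IsOrthogonal.smul {U : ℕ → F} {A : PseudoDiffOp δ} (hA : IsOrthogonal U A) (f : F) :
    IsOrthogonal U (f • A) := by
  intro a
  induction a generalizing f A with
  | zero => exact (residuePairing_smul U f A).trans (by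
      rw [show residuePairing U A = 0 from hA 0, mul_zero])
  | succ a ih =>
    rw [Function.iterate_succ_apply, deriv_smul, iterate_deriv_add, residuePairing_add,
      ih hA, ih hA.deriv, add_zero]

theorem IsOrthogonal.sub {U : ℕ → F} {A B : PseudoDiffOp δ} (hA : IsOrthogonal U A)
    (hB : IsOrthogonal U B) : IsOrthogonal U (A - B) := by
  have h : A - B = A + (-1 : F) • B := by ext n; simp; ring
  rw [h]
  exact hA.add (hB.smul _)

theorem iterate_deriv_eq_dpow (a : ℕ) (A : PseudoDiffOp δ) : deriv^[a] A = dpow a A := by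
  induction a with
  | zero => exact (dpow_zero A).symm
  | succ a ih => rw [Function.iterate_succ_apply', ih, deriv_dpow, Nat.cast_succ]

/-- An orthogonal symbol of negative order vanishes: if its order is `-m`, then `∂^(m-1) ∘ A` has
order `-1` and the same leading coefficient, which is therefore the value of a pairing. -/
theorem IsOrthogonal.eq_zero {U : ℕ → F} (hU : U 0 = 1) {A : PseudoDiffOp δ}
    (hA : IsOrthogonal U A) (hA' : ∀ n, 0 ≤ n → A.coeff n = 0) : A = 0 := by
  by_contra hne
  obtain ⟨N, h1, h2⟩ := exists_top hne
  have hN : N < 0 := by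
    by_contra h
    exact h1 (hA' N (by omega))
  obtain ⟨a, ha⟩ : ∃ a : ℕ, N + a = -1 := ⟨(-1 - N).toNat, by omega⟩
  refine h1 ?_
  have h3 := hA a
  rwa [iterate_deriv_eq_dpow, residuePairing_eq_top U
    (fun n hn => coeff_dpow_eq_zero a n h2 (by omega)), hU, mul_one, ← ha,
    coeff_dpow_top _ h2] at h3

/-- The bilinear identities imply the Schrödinger equation `L ψ = z² ψ`: the potential is chosen so
that `L W - z² W` has negative order, and this difference is orthogonal to `U`. -/
theorem IsOrthogonal.schrodinger_mul {U : ℕ → F} (hU : U 0 = 1) {W : PseudoDiffOp δ}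
    (h0 : W.coeff 0 = 1) (hW : ∀ n, 0 < n → W.coeff n = 0) (h : IsOrthogonal U W)
    (h' : IsOrthogonal U (shift 2 W)) :
    schrodinger δ (-2 * δ (W.coeff (-1))) * W = shift 2 W := by
  rw [PseudoDiffOp.schrodinger_mul, ← sub_eq_zero]
  refine ((h.deriv.deriv.add (h.smul _)).sub h').eq_zero hU fun n hn => ?_
  simp only [coeff_sub, coeff_add, coeff_deriv, coeff_smul, coeff_shift, map_add]
  obtain rfl | rfl | hn : n = 0 ∨ n = 1 ∨ 2 ≤ n := by omega
  · norm_num [h0]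
    ring
  · norm_num [h0, hW 1 one_pos]
  · rw [hW n (by omega), hW (n - 1) (by omega), sub_sub]
    norm_num

/-- The residue of an operator is read off from its action on the wave function. Expand `P ∘ W`
in the operators `∂ⁱ ∘ W`: those with `i ≥ 0` are orthogonal to `U`, those with `i < -1` have no
coefficient of `z⁻¹`, and `i = -1` contributes `1`. -/
theorem IsOrthogonal.residuePairing_mul {U : ℕ → F} (hU : U 0 = 1) {W : PseudoDiffOp δ}
    (h0 : W.coeff 0 = 1) (hW : ∀ n, 0 < n → W.coeff n = 0) (h : IsOrthogonal U W)
    (P : PseudoDiffOp δ) : residuePairing U (P * W) = P.residue := by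
  obtain ⟨M, hP⟩ := P.bounded
  obtain ⟨K, hK⟩ : ∃ K : ℕ, M + 1 < K := ⟨(M + 1).toNat + 1, by omega⟩
  have hdp : ∀ i : ℤ, residuePairing U (dpow i W) = if i = -1 then 1 else 0 := by
    intro i
    obtain hi | rfl | hi : 0 ≤ i ∨ i = -1 ∨ i < -1 := by omega
    · obtain ⟨a, rfl⟩ := Int.eq_ofNat_of_zero_le hi
      rw [← iterate_deriv_eq_dpow, h a, if_neg (by omega)]
    · have h1 := coeff_dpow_top (-1) hW
      rw [zero_add, h0] at h1
      rw [residuePairing_eq_top U (fun n hn => coeff_dpow_eq_zero _ _ hW (by omega)), h1, hU,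
        if_pos rfl, mul_one]
    · rw [residuePairing_eq_top U (fun n hn => coeff_dpow_eq_zero _ _ hW (by omega)),
        coeff_dpow_eq_zero _ _ hW (by omega), zero_mul, if_neg hi.ne]
  have hs : ∀ k ∈ Finset.range K, (P * W).coeff (k - 1) * U k =
      ∑ i ∈ Finset.Icc (-1) M, P.coeff i * ((dpow i W).coeff (k - 1) * U k) := fun k _ => by
    rw [coeff_mul_eq_sum _ hP hW (a := -1) (by omega) le_rfl, Finset.sum_mul]
    exact Finset.sum_congr rfl fun i _ => mul_assoc _ _ _
  rw [residuePairing_eq_sum U (fun n hn => coeff_mul_eq_zero hP hW hn) (K := K) (by omega),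
    Finset.sum_congr rfl hs, Finset.sum_comm]
  have hs' : ∀ i ∈ Finset.Icc (-1) M, ∑ k ∈ Finset.range K,
      P.coeff i * ((dpow i W).coeff (k - 1) * U k) = P.coeff i * if i = -1 then 1 else 0 := by
    intro i hi
    rw [Finset.mem_Icc] at hi
    rw [← hdp, residuePairing_eq_sum U (N := i) (fun n hn => coeff_dpow_eq_zero i n hW (by omega))
      (K := K) (by omega), Finset.mul_sum]
  rw [Finset.sum_congr rfl hs', residue]
  simp only [mul_ite, mul_one, mul_zero, Finset.sum_ite_eq', Finset.mem_Icc, le_refl, true_and]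
  split_ifs with hM
  · rfl
  · exact (hP _ (by omega)).symm

end PseudoDiffOp

/-! ### Substitution and differentiation of power series -/

namespace MvPowerSeries

open scoped MvPowerSeries.WithPiTopology

variable {σ υ R : Type*} [CommRing R]

theorem continuous_pderiv [TopologicalSpace R] [IsTopologicalSemiring R] (i : σ) :
    Continuous (pderiv R i : MvPowerSeries σ R → MvPowerSeries σ R) := by
  refine continuous_pi fun n => ?_
  have h : (fun f : MvPowerSeries σ R => pderiv R i f n) =
      fun f => coeff (n + Finsupp.single i 1) f * ((n i : R) + 1) := by
    funext f
    exact coeff_pderiv f n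
  rw [h]
  exact (WithPiTopology.continuous_coeff R _).mul continuous_const

/-- The chain rule, for a substitution in which only the series substituted for the variable `j`
depends on the variable `i`. -/
theorem pderiv_subst {a : σ → MvPowerSeries υ R} (ha : HasSubst a) {i : υ} {j : σ}
    {c : MvPowerSeries υ R} (hj : pderiv R i (a j) = c) (hne : ∀ k ≠ j, pderiv R i (a k) = 0)
    (f : MvPowerSeries σ R) : pderiv R i (subst a f) = c * subst a (pderiv R j f) := by
  classical
  -- Both sides are continuous in `f` for the discrete topology on `R`, and polynomials are dense.
  let : UniformSpace R := ⊥
  have : DiscreteUniformity R := ⟨rfl⟩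
  refine congrFun (DenseRange.equalizer WithPiTopology.denseRange_toMvPowerSeries
    (g := fun f => pderiv R i (subst a f)) (h := fun f => c * subst a (pderiv R j f))
    ((continuous_pderiv i).comp (continuous_subst ha))
    (continuous_const.mul ((continuous_subst ha).comp (continuous_pderiv j))) ?_) f
  funext p
  simp only [Function.comp_apply]
  induction p using MvPolynomial.induction_on with
  | C r =>
    rw [MvPolynomial.coe_C, subst_C, pderiv_C, pderiv_C, ← coe_substAlgHom ha, map_zero, mul_zero]
  | add p q hp hq =>
    rw [MvPolynomial.coe_add, subst_add ha, map_add, hp, hq, map_add, subst_add ha, mul_add]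
  | mul_X p k hp =>
    rw [MvPolynomial.coe_mul, MvPolynomial.coe_X, subst_mul ha, subst_X ha, Derivation.leibniz,
      Derivation.leibniz, hp, smul_eq_mul, smul_eq_mul, smul_eq_mul, smul_eq_mul, subst_add ha,
      subst_mul ha, subst_mul ha, subst_X ha, pderiv_X]
    by_cases hk : k = j
    · subst hk
      rw [hj, Pi.single_eq_same, ← coe_substAlgHom ha, map_one]
      ring
    · rw [hne k hk, Pi.single_eq_of_ne hk, ← coe_substAlgHom ha, map_zero]
      ring

theorem continuous_coeff_optionEquivLeft_subst [UniformSpace R] [DiscreteUniformity R] {ι : Type*}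
    {a : ι → MvPowerSeries (Option σ) R} (ha : HasSubst a) (n : ℕ) :
    Continuous fun f : MvPowerSeries ι R =>
      PowerSeries.coeff n (optionEquivLeft σ R (subst a f)) := by
  refine continuous_pi fun x => ?_
  have h : (fun f : MvPowerSeries ι R => PowerSeries.coeff n (optionEquivLeft σ R (subst a f)) x)
      = fun f => coeff (x.optionElim n) (subst a f) := by
    funext f
    exact coeff_coeff_optionEquivLeft _ n x
  rw [h]
  exact (WithPiTopology.continuous_coeff R _).comp (continuous_subst ha)

/-- The first two coefficients, in the variable `none`, of a substitution `t ↦ t + O(w)`. -/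
theorem coeff_zero_one_optionEquivLeft_subst {a : σ → MvPowerSeries (Option σ) R}
    (ha : HasSubst a) (h0 : ∀ k, PowerSeries.coeff 0 (optionEquivLeft σ R (a k)) = X k)
    {j : σ} {c : MvPowerSeries σ R} (hj : PowerSeries.coeff 1 (optionEquivLeft σ R (a j)) = c)
    (hne : ∀ k ≠ j, PowerSeries.coeff 1 (optionEquivLeft σ R (a k)) = 0)
    (f : MvPowerSeries σ R) :
    PowerSeries.coeff 0 (optionEquivLeft σ R (subst a f)) = f ∧
      PowerSeries.coeff 1 (optionEquivLeft σ R (subst a f)) = c * pderiv R j f := by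
  classical
  let : UniformSpace R := ⊥
  have : DiscreteUniformity R := ⟨rfl⟩
  have hpoly : ∀ p : MvPolynomial σ R,
      PowerSeries.coeff 0 (optionEquivLeft σ R (subst a (p : MvPowerSeries σ R))) = p ∧
      PowerSeries.coeff 1 (optionEquivLeft σ R (subst a (p : MvPowerSeries σ R))) =
        c * pderiv R j (p : MvPowerSeries σ R) := by
    intro p
    induction p using MvPolynomial.induction_on with
    | C r =>
      rw [MvPolynomial.coe_C, subst_C, pderiv_C, optionEquivLeft_C, PowerSeries.coeff_C, PowerSeries.coeff_C]
      simp
    | add p q hp hq =>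
      rw [MvPolynomial.coe_add, subst_add ha, map_add, map_add, map_add, hp.1, hp.2, hq.1, hq.2,
        map_add, mul_add]
      exact ⟨rfl, rfl⟩
    | mul_X p k hp =>
      rw [MvPolynomial.coe_mul, MvPolynomial.coe_X, subst_mul ha, subst_X ha, Derivation.leibniz,
        map_mul, PowerSeries.coeff_zero_eq_constantCoeff_apply, map_mul, PowerSeries.coeff_one_mul,
        ← PowerSeries.coeff_zero_eq_constantCoeff_apply,
        ← PowerSeries.coeff_zero_eq_constantCoeff_apply, hp.1, hp.2, h0, pderiv_X, smul_eq_mul,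
        smul_eq_mul]
      refine ⟨rfl, ?_⟩
      by_cases hk : k = j
      · subst hk
        rw [hj, Pi.single_eq_same]
        ring
      · rw [hne k hk, Pi.single_eq_of_ne hk]
        ring
  constructor
  · refine congrFun (DenseRange.equalizer WithPiTopology.denseRange_toMvPowerSeries
      (g := fun f => PowerSeries.coeff 0 (optionEquivLeft σ R (subst a f))) (h := fun f => f)
      (continuous_coeff_optionEquivLeft_subst ha 0) continuous_id ?_) f
    funext p
    exact (hpoly p).1
  · refine congrFun (DenseRange.equalizer WithPiTopology.denseRange_toMvPowerSeries
      (g := fun f => PowerSeries.coeff 1 (optionEquivLeft σ R (subst a f)))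
      (h := fun f => c * pderiv R j f)
      (continuous_coeff_optionEquivLeft_subst ha 1) (continuous_const.mul (continuous_pderiv j)) ?_) f
    funext p
    exact (hpoly p).2

/-- Renaming the variables other than `none` in the result of a substitution. -/
theorem rename_coeff_optionEquivLeft_subst {ι : Type*} {a : ι → MvPowerSeries (Option σ) R}
    {b : ι → MvPowerSeries (Option υ) R} (ha : HasSubst a) (hb : HasSubst b) {e : σ → υ}
    [Filter.TendstoCofinite e]
    (h : ∀ k, PowerSeries.map (rename e : _ →ₐ[R] _).toRingHom (optionEquivLeft σ R (a k)) =
      optionEquivLeft υ R (b k)) (n : ℕ) (f : MvPowerSeries ι R) :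
    rename e (PowerSeries.coeff n (optionEquivLeft σ R (subst a f))) =
      PowerSeries.coeff n (optionEquivLeft υ R (subst b f)) := by
  let : UniformSpace R := ⊥
  have : DiscreteUniformity R := ⟨rfl⟩
  have hren : Continuous (rename e : MvPowerSeries σ R → MvPowerSeries υ R) := by
    have h1 : (rename e : MvPowerSeries σ R → MvPowerSeries υ R) = subst (X ∘ e) :=
      funext fun p => rename_eq_subst e p
    rw [h1]
    exact continuous_subst (HasSubst.X_comp e)
  refine congrFun (DenseRange.equalizer WithPiTopology.denseRange_toMvPowerSeries
    (g := fun f => rename e (PowerSeries.coeff n (optionEquivLeft σ R (subst a f))))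
    (h := fun f => PowerSeries.coeff n (optionEquivLeft υ R (subst b f)))
    (hren.comp (continuous_coeff_optionEquivLeft_subst ha n))
    (continuous_coeff_optionEquivLeft_subst hb n) ?_) f
  funext p
  have hp : PowerSeries.map (rename e : _ →ₐ[R] _).toRingHom
      (optionEquivLeft σ R (subst a (p : MvPowerSeries ι R))) =
      optionEquivLeft υ R (subst b (p : MvPowerSeries ι R)) := by
    induction p using MvPolynomial.induction_on with
    | C r =>
      rw [MvPolynomial.coe_C, subst_C, subst_C, optionEquivLeft_C, optionEquivLeft_C,
        PowerSeries.map_C]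
      exact congrArg PowerSeries.C (rename_C e r)
    | add p q hp hq =>
      rw [MvPolynomial.coe_add, subst_add ha, subst_add hb, map_add, map_add, map_add, hp, hq]
    | mul_X p k hp =>
      rw [MvPolynomial.coe_mul, MvPolynomial.coe_X, subst_mul ha, subst_mul hb, subst_X ha,
        subst_X hb, map_mul, map_mul, map_mul, hp, h]
  exact congrArg (PowerSeries.coeff n) hp

theorem pderiv_coeff_optionEquivLeft (p : MvPowerSeries (Option σ) R) (n : ℕ) (i : σ) :
    pderiv R i (PowerSeries.coeff n (optionEquivLeft σ R p)) =
      PowerSeries.coeff n (optionEquivLeft σ R (pderiv R (some i) p)) := by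
  ext x
  rw [coeff_pderiv, coeff_coeff_optionEquivLeft, coeff_coeff_optionEquivLeft, coeff_pderiv]
  have h : (x + Finsupp.single i 1).optionElim n =
      x.optionElim n + Finsupp.single (some i) 1 := by
    classical
    ext u
    cases u <;> simp [Finsupp.single_apply]
  rw [h, Finsupp.optionElim_apply_some]

theorem pderiv_subst_exp [Algebra ℚ R] {φ : MvPowerSeries σ R} (hφ : constantCoeff φ = 0) (i : σ) :
    pderiv R i ((PowerSeries.exp R).subst φ) = pderiv R i φ * (PowerSeries.exp R).subst φ := by
  have h : pderiv R () (PowerSeries.exp R : MvPowerSeries Unit R) = PowerSeries.exp R := by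
    have h1 := PowerSeries.derivative_exp R
    exact h1
  have h2 := pderiv_subst (i := i) (j := ()) (PowerSeries.HasSubst.of_constantCoeff_zero hφ).const
    rfl (fun k hk => absurd (Subsingleton.elim k ()) hk) (PowerSeries.exp R)
  rw [h] at h2
  exact h2

theorem subst_exp_mul_subst_exp_neg [Algebra ℚ R] {φ : MvPowerSeries σ R}
    (hφ : constantCoeff φ = 0) :
    (PowerSeries.exp R).subst φ * (PowerSeries.exp R).subst (-φ) = 1 := by
  have ha := PowerSeries.HasSubst.of_constantCoeff_zero hφ
  have h := congrArg (PowerSeries.substAlgHom ha) (PowerSeries.exp_mul_exp_neg_eq_one (A := R))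
  have h2 : PowerSeries.evalNegHom (PowerSeries.exp R) =
      (PowerSeries.exp R).subst ((-1 : R) • (PowerSeries.X : PowerSeries R)) :=
    PowerSeries.rescale_eq_subst _ _
  rw [map_mul, map_one, h2, PowerSeries.coe_substAlgHom,
    PowerSeries.subst_comp_subst_apply (PowerSeries.HasSubst.smul_X' _) ha,
    PowerSeries.subst_smul ha, PowerSeries.subst_X ha, neg_one_smul] at h
  exact h

end MvPowerSeries

/-! ### Shifts of the times and the phase -/

namespace KdV

open MvPowerSeries

theorem hasSubst_shiftedTime {σ : Type} (ε : ℂ) {s : ℕ → σ} (hs : Function.Injective s) :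
    HasSubst (shiftedTime ε s) where
  const_coeff k := by
    simp [shiftedTime]
  coeff_zero d := by
    classical
    have h1 : {k : ℕ | d = Finsupp.single (some (s k)) 1}.Finite := by
      refine Set.Subsingleton.finite fun k hk l hl => ?_
      have h := hk.symm.trans hl
      exact hs (Option.some_injective _ (Finsupp.single_left_injective one_ne_zero h))
    have h2 : {k : ℕ | d = Finsupp.single none (2 * k + 1)}.Finite := by
      refine Set.Subsingleton.finite fun k hk l hl => ?_
      have h := hk.symm.trans hl
      have := Finsupp.single_injective _ h
      omega
    refine (h1.union h2).subset fun k hk => ?_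
    by_contra h
    simp only [Set.mem_union, Set.mem_ofPred_eq, not_or] at h
    refine hk ?_
    rw [shiftedTime, map_add, coeff_C_mul, coeff_X, coeff_X_pow, if_neg h.1, if_neg h.2, mul_zero,
      add_zero]

theorem pderiv_shiftedTime {σ : Type} (ε : ℂ) (s : ℕ → σ) (i : σ) (k : ℕ) [Decidable (s k = i)] :
    pderiv ℂ (some i) (shiftedTime ε s k) = if s k = i then 1 else 0 := by
  classical
  rw [shiftedTime, map_add, Derivation.leibniz, pderiv_C, pderiv_pow, pderiv_X, pderiv_X]
  by_cases h : s k = i <;> simp [h]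

/-- The shift of the times commutes with `∂/∂t_j`. -/
theorem pderiv_coeff_shift {σ : Type} (ε : ℂ) {s : ℕ → σ} (hs : Function.Injective s) (j n : ℕ)
    (g : Fock) : pderiv ℂ (s j) (PowerSeries.coeff n (shift ε s g)) =
      PowerSeries.coeff n (shift ε s (pderiv ℂ j g)) := by
  classical
  rw [shift, pderiv_coeff_optionEquivLeft, pderiv_subst (hasSubst_shiftedTime ε hs) (j := j)
    (c := 1) (by rw [pderiv_shiftedTime, if_pos rfl])
    (fun k hk => by rw [pderiv_shiftedTime, if_neg fun h => hk (hs h)]), one_mul, shift]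

theorem pderiv_coeff_shift_of_notMem {σ : Type} (ε : ℂ) {s : ℕ → σ} (hs : Function.Injective s)
    {i : σ} (hi : i ∉ Set.range s) (n : ℕ) (g : Fock) :
    pderiv ℂ i (PowerSeries.coeff n (shift ε s g)) = 0 := by
  classical
  have h : ∀ k, pderiv ℂ (some i) (shiftedTime ε s k) = 0 := fun k => by
    rw [pderiv_shiftedTime, if_neg fun h => hi ⟨k, h⟩]
  rw [shift, pderiv_coeff_optionEquivLeft, pderiv_subst (hasSubst_shiftedTime ε hs) (j := 0)
    (h 0) (fun k _ => h k), zero_mul, map_zero, map_zero]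

/-- The expansion `g(t + ε [z⁻¹]) = g + ε (∂g/∂t₀) z⁻¹ + O(z⁻²)`. -/
theorem coeff_zero_one_shift (ε : ℂ) (g : Fock) :
    PowerSeries.coeff 0 (shift ε id g) = g ∧
      PowerSeries.coeff 1 (shift ε id g) = C ε * pderiv ℂ 0 g := by
  have h1 : ∀ k, optionEquivLeft ℕ ℂ (shiftedTime ε id k) = PowerSeries.C (X k) +
      PowerSeries.C (C (ε * ((2 * k - 1).doubleFactorial : ℂ))) * PowerSeries.X ^ (2 * k + 1) :=
    fun k => by
      rw [shiftedTime, map_add, map_mul, map_pow, optionEquivLeft_X_some, optionEquivLeft_C,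
        optionEquivLeft_X_none, id]
  refine coeff_zero_one_optionEquivLeft_subst (hasSubst_shiftedTime ε Function.injective_id)
    (fun k => ?_) ?_ (fun k hk => ?_) g
  · rw [h1]
    simp
  · rw [h1]
    simp [PowerSeries.coeff_C]
  · rw [h1, map_add, PowerSeries.coeff_C_mul, PowerSeries.coeff_X_pow, if_neg (by omega),
      PowerSeries.coeff_C, if_neg one_ne_zero, mul_zero, add_zero]

instance : Filter.TendstoCofinite (Sum.elim id id : ℕ ⊕ ℕ → ℕ) := by
  rw [Filter.tendstoCofinite_iff_finite_preimage_singleton]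
  intro n
  refine (Set.toFinite {Sum.inl n, Sum.inr n}).subset ?_
  rintro (k | k) hk <;> simp_all

/-- Restriction of a power series in two families of times to the diagonal `t' = t`. -/
def diagonal (A : Type) [CommRing A] : MvPowerSeries (ℕ ⊕ ℕ) A →ₐ[A] MvPowerSeries ℕ A :=
  rename (Sum.elim id id)

theorem diagonal_coeff_shift (ε : ℂ) {s : ℕ → ℕ ⊕ ℕ} (hs : Function.Injective s)
    (hs' : ∀ k, Sum.elim id id (s k) = k) (n : ℕ) (g : Fock) :
    diagonal ℂ (PowerSeries.coeff n (shift ε s g)) = PowerSeries.coeff n (shift ε id g) := by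
  have h1 : ∀ (σ : Type) (s : ℕ → σ) (k : ℕ), optionEquivLeft σ ℂ (shiftedTime ε s k) =
      PowerSeries.C (X (s k)) +
      PowerSeries.C (C (ε * ((2 * k - 1).doubleFactorial : ℂ))) * PowerSeries.X ^ (2 * k + 1) :=
    fun σ s k => by
      rw [shiftedTime, map_add, map_mul, map_pow, optionEquivLeft_X_some, optionEquivLeft_C,
        optionEquivLeft_X_none]
  refine rename_coeff_optionEquivLeft_subst (hasSubst_shiftedTime ε hs)
    (hasSubst_shiftedTime ε Function.injective_id) (fun k => ?_) n g
  rw [h1, h1, map_add, map_mul, map_pow, PowerSeries.map_C, PowerSeries.map_C, PowerSeries.map_X]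
  have h2 : ∀ p : MvPowerSeries (ℕ ⊕ ℕ) ℂ,
      (rename (Sum.elim id id : ℕ ⊕ ℕ → ℕ) : _ →ₐ[ℂ] _).toRingHom p = rename (Sum.elim id id) p :=
    fun _ => rfl
  rw [h2, h2, rename_X, rename_C, hs', id]

theorem finite_phase_support {σ : Type} {s : ℕ → σ} (hs : Function.Injective s) (α : σ →₀ ℕ)
    (c : ℕ → LaurentSeries ℂ) :
    (Function.support fun j : ℕ => coeff α (C (c j) * X (s j))).Finite := by
  classical
  refine Set.Subsingleton.finite fun k hk l hl => ?_
  rw [Function.mem_support, coeff_C_mul, coeff_X] at hk hl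
  have hk' : α = Finsupp.single (s k) 1 := by
    by_contra h
    rw [if_neg h, mul_zero] at hk
    exact hk rfl
  have hl' : α = Finsupp.single (s l) 1 := by
    by_contra h
    rw [if_neg h, mul_zero] at hl
    exact hl rfl
  exact hs (Finsupp.single_left_injective one_ne_zero (hk'.symm.trans hl'))

/-- The coefficient `z^{2j+1} / (2j+1)!!` of the time `t_j` in the phase. -/
def phaseCoeff (j : ℕ) : LaurentSeries ℂ :=
  HahnSeries.C ((2 * j + 1).doubleFactorial : ℂ)⁻¹ * zPow (2 * j + 1)

theorem coeff_phase {σ : Type} (s : ℕ → σ) (α : σ →₀ ℕ) :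
    coeff α (phase s) = ∑ᶠ j : ℕ, coeff α (C (phaseCoeff j) * X (s j)) := rfl

theorem constantCoeff_phase {σ : Type} (s : ℕ → σ) : constantCoeff (phase s) = 0 := by
  rw [← coeff_zero_eq_constantCoeff_apply, coeff_phase]
  refine (finsum_congr fun j => ?_).trans finsum_zero
  simp

theorem pderiv_phase {σ : Type} {s : ℕ → σ} (hs : Function.Injective s) (j : ℕ) :
    pderiv _ (s j) (phase s) = C (phaseCoeff j) := by
  classical
  ext1 α
  rw [coeff_pderiv, coeff_phase, finsum_mul' _ _ (finite_phase_support hs _ _)]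
  rw [finsum_eq_single _ j]
  · rw [← coeff_pderiv, Derivation.leibniz, pderiv_C, pderiv_X_self]
    simp
  · intro k hk
    rw [← coeff_pderiv, Derivation.leibniz, pderiv_C, pderiv_X_of_ne fun h => hk (hs h)]
    simp

theorem pderiv_phase_of_notMem {σ : Type} {s : ℕ → σ} (hs : Function.Injective s) {i : σ}
    (hi : i ∉ Set.range s) : pderiv _ i (phase s) = 0 := by
  ext1 α
  rw [coeff_pderiv, coeff_phase, finsum_mul' _ _ (finite_phase_support hs _ _), map_zero,
    ← finsum_zero (α := ℕ)]
  refine finsum_congr fun k => ?_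
  rw [← coeff_pderiv, Derivation.leibniz, pderiv_C, pderiv_X_of_ne fun h => hi ⟨k, h⟩]
  simp

theorem diagonal_phase {s : ℕ → ℕ ⊕ ℕ} (hs : Function.Injective s)
    (hs' : ∀ k, Sum.elim id id (s k) = k) : diagonal _ (phase s) = phase id := by
  ext1 α
  rw [diagonal, coeff_rename, coeff_phase]
  simp only [coeff_phase]
  rw [← finsum_sum_comm _ (fun (j : ℕ) β => coeff β (C (phaseCoeff j) * X (s j)))
    fun β _ => finite_phase_support hs β _]
  refine finsum_congr fun j => ?_
  rw [← coeff_rename, map_mul, rename_C, rename_X, hs', id]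

theorem diagonal_expSeries_sub :
    diagonal _ (expSeries (phase Sum.inl - phase Sum.inr)) = 1 := by
  have h0 : constantCoeff (phase (Sum.inl : ℕ → ℕ ⊕ ℕ) - phase Sum.inr) = 0 := by
    rw [map_sub, constantCoeff_phase, constantCoeff_phase, sub_zero]
  have h1 : subst (X ∘ Sum.elim id id : ℕ ⊕ ℕ → MvPowerSeries ℕ (LaurentSeries ℂ))
      (phase Sum.inl - phase Sum.inr) = 0 := by
    rw [← rename_eq_subst]
    change diagonal _ _ = 0
    rw [map_sub, diagonal_phase Sum.inl_injective fun _ => rfl,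
      diagonal_phase Sum.inr_injective fun _ => rfl, sub_self]
  have h2 := subst_comp_subst_apply (PowerSeries.HasSubst.of_constantCoeff_zero h0).const
    (HasSubst.X_comp (R := LaurentSeries ℂ) (Sum.elim id id : ℕ ⊕ ℕ → ℕ))
    (PowerSeries.exp (LaurentSeries ℂ))
  rw [diagonal, rename_eq_subst]
  refine h2.trans ?_
  rw [h1]
  exact (PowerSeries.subst_zero_eq_C_constantCoeff).trans (by
    rw [PowerSeries.constantCoeff_exp, map_one, map_one])

/-! ### Power series in `z⁻¹` as Laurent series -/

theorem coeff_coeff_toLaurent {σ : Type} (f : PowerSeries (MvPowerSeries σ ℂ)) (α : σ →₀ ℕ)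
    (n : ℕ) : (coeff α (toLaurent f)).coeff n = coeff α (PowerSeries.coeff n f) := by
  change (HahnSeries.ofPowerSeries ℤ ℂ _).coeff (n : ℤ) = _
  rw [HahnSeries.ofPowerSeries_apply_coeff, PowerSeries.coeff_mk]

theorem toLaurent_ext {σ : Type} {f : PowerSeries (MvPowerSeries σ ℂ)}
    {α : σ →₀ ℕ} {x : LaurentSeries ℂ} {p : PowerSeries ℂ} (hx : x = HahnSeries.ofPowerSeries ℤ ℂ p)
    (h : ∀ n, coeff α (PowerSeries.coeff n f) = PowerSeries.coeff n p) :
    coeff α (toLaurent f) = x := by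
  rw [hx]
  change HahnSeries.ofPowerSeries ℤ ℂ _ = _
  congr 1
  ext n
  rw [PowerSeries.coeff_mk, h]

theorem toLaurent_mul {σ : Type} (f g : PowerSeries (MvPowerSeries σ ℂ)) :
    toLaurent (f * g) = toLaurent f * toLaurent g := by
  classical
  ext1 α
  refine toLaurent_ext (p := ∑ x ∈ Finset.HasAntidiagonal.antidiagonal α,
    (PowerSeries.mk fun m => coeff x.1 (PowerSeries.coeff m f)) *
      PowerSeries.mk fun m => coeff x.2 (PowerSeries.coeff m g)) ?_ fun n => ?_
  · rw [MvPowerSeries.coeff_mul, map_sum]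
    refine Finset.sum_congr rfl fun x _ => ?_
    rw [map_mul]
    rfl
  · rw [PowerSeries.coeff_mul, map_sum, map_sum]
    simp only [PowerSeries.coeff_mul, MvPowerSeries.coeff_mul, PowerSeries.coeff_mk]
    exact Finset.sum_comm

theorem pderiv_toLaurent {σ : Type} (i : σ) {f g : PowerSeries (MvPowerSeries σ ℂ)}
    (h : ∀ n, pderiv ℂ i (PowerSeries.coeff n f) = PowerSeries.coeff n g) :
    pderiv _ i (toLaurent f) = toLaurent g := by
  ext1 α
  refine (toLaurent_ext (p := PowerSeries.C ((α i : ℂ) + 1) * PowerSeries.mk fun m =>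
    coeff (α + Finsupp.single i 1) (PowerSeries.coeff m f)) ?_ fun n => ?_).symm
  · rw [coeff_pderiv, map_mul, HahnSeries.ofPowerSeries_C, mul_comm]
    simp
    rfl
  · rw [← h, coeff_pderiv, PowerSeries.coeff_C_mul, PowerSeries.coeff_mk, mul_comm]

theorem diagonal_toLaurent {f : PowerSeries (MvPowerSeries (ℕ ⊕ ℕ) ℂ)} {g : PowerSeries Fock}
    (h : ∀ n, diagonal ℂ (PowerSeries.coeff n f) = PowerSeries.coeff n g) :
    diagonal _ (toLaurent f) = toLaurent g := by
  ext1 α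
  refine (toLaurent_ext (p := ∑ β ∈ (Filter.TendstoCofinite.finite_preimage_singleton
    (Finsupp.mapDomain (Sum.elim id id : ℕ ⊕ ℕ → ℕ)) α).toFinset,
    PowerSeries.mk fun m => coeff β (PowerSeries.coeff m f)) ?_ fun n => ?_).symm
  · rw [diagonal, coeff_rename, map_sum]
    rfl
  · rw [← h, diagonal, coeff_rename, map_sum]
    simp only [PowerSeries.coeff_mk]

end KdV

/-! ### The bilinear identities at coinciding times -/

namespace KdV

open MvPowerSeries

/-- The integrand `g(t - [z⁻¹]) τ(t' + [z⁻¹]) e^{ϑ(z; t) - ϑ(z; t')} zⁿ` of the Hirota identities,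
with the first factor `τ` replaced by `g`. -/
def hirotaTerm (τ : Fock) (n : ℕ) (g : Fock) : MvPowerSeries (ℕ ⊕ ℕ) (LaurentSeries ℂ) :=
  toLaurent (shift (-1) Sum.inl g) * toLaurent (shift 1 Sum.inr τ) *
    expSeries (phase Sum.inl - phase Sum.inr) * C (zPow n)

/-- The coefficient of `z⁻¹` in `g(t - [z⁻¹]) τ(t + [z⁻¹]) zⁿ`, which is the coefficient of
`w^{n+1}` in the power series `g(t - [w]) τ(t + [w])`. -/
def hirotaCoeff (τ : Fock) (n : ℕ) (g : Fock) : Fock :=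
  PowerSeries.coeff (n + 1) (shift (-1) id g * shift 1 id τ)

/-- The coefficient of `z⁻¹` of the restriction to `t' = t`. -/
def diagonalResidue (Φ : MvPowerSeries (ℕ ⊕ ℕ) (LaurentSeries ℂ)) : Fock :=
  fun α => (coeff α (diagonal _ Φ)).coeff 1

theorem coeff_diagonalResidue (Φ : MvPowerSeries (ℕ ⊕ ℕ) (LaurentSeries ℂ)) (α : ℕ →₀ ℕ) :
    coeff α (diagonalResidue Φ) = (coeff α (diagonal _ Φ)).coeff 1 := rfl

theorem diagonalResidue_add (Φ Ψ : MvPowerSeries (ℕ ⊕ ℕ) (LaurentSeries ℂ)) :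
    diagonalResidue (Φ + Ψ) = diagonalResidue Φ + diagonalResidue Ψ := by
  ext1 α
  rw [map_add, coeff_diagonalResidue, map_add, map_add, HahnSeries.coeff_add]
  rfl

theorem diagonalResidue_C_mul (c : ℂ) (Φ : MvPowerSeries (ℕ ⊕ ℕ) (LaurentSeries ℂ)) :
    diagonalResidue (C (HahnSeries.C c) * Φ) = C c * diagonalResidue Φ := by
  ext1 α
  rw [coeff_C_mul, coeff_diagonalResidue, map_mul, diagonal, rename_C, coeff_C_mul,
    HahnSeries.C_mul_eq_smul, HahnSeries.coeff_smul]
  rfl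

theorem diagonalResidue_eq_zero {Φ : MvPowerSeries (ℕ ⊕ ℕ) (LaurentSeries ℂ)}
    (h : ∀ α, (coeff α Φ).coeff 1 = 0) : diagonalResidue Φ = 0 := by
  ext1 α
  rw [coeff_diagonalResidue, diagonal, coeff_rename, HahnSeries.coeff_sum, map_zero]
  exact Finset.sum_eq_zero fun β _ => h β

theorem residue_pderiv_eq_zero {Φ : MvPowerSeries (ℕ ⊕ ℕ) (LaurentSeries ℂ)}
    (h : ∀ α, (coeff α Φ).coeff 1 = 0) (i : ℕ ⊕ ℕ) (α : ℕ ⊕ ℕ →₀ ℕ) :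
    (coeff α (pderiv _ i Φ)).coeff 1 = 0 := by
  have h1 : ((α i : LaurentSeries ℂ) + 1) = HahnSeries.C ((α i : ℂ) + 1) := by
    rw [map_add, map_natCast, map_one]
  rw [coeff_pderiv, mul_comm, h1, HahnSeries.C_mul_eq_smul, HahnSeries.coeff_smul, h, smul_zero]

theorem diagonalResidue_hirotaTerm (τ : Fock) (n : ℕ) (g : Fock) :
    diagonalResidue (hirotaTerm τ n g) = hirotaCoeff τ n g := by
  ext1 α
  have h1 : diagonal _ (hirotaTerm τ n g) =
      toLaurent (shift (-1) id g * shift 1 id τ) * C (zPow n) := by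
    rw [hirotaTerm, map_mul, map_mul, map_mul, diagonal_expSeries_sub, mul_one,
      diagonal_toLaurent (diagonal_coeff_shift (-1) Sum.inl_injective (fun _ => rfl) · g),
      diagonal_toLaurent (diagonal_coeff_shift 1 Sum.inr_injective (fun _ => rfl) · τ),
      toLaurent_mul, diagonal, rename_C]
  rw [coeff_diagonalResidue, h1, coeff_mul_C, zPow, hirotaCoeff, ← coeff_coeff_toLaurent]
  have h2 := HahnSeries.coeff_mul_single_add (r := (1 : ℂ))
    (x := coeff α (toLaurent (shift (-1) id g * shift 1 id τ))) (a := ((n + 1 : ℕ) : ℤ))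
    (b := -(n : ℤ))
  rw [mul_one] at h2
  rw [← h2]
  congr 1
  push_cast
  ring

theorem pderiv_hirotaTerm (τ : Fock) (n : ℕ) (g : Fock) (j : ℕ) :
    pderiv _ (Sum.inl j) (hirotaTerm τ n g) = hirotaTerm τ n (pderiv ℂ j g) +
      C (HahnSeries.C ((2 * j + 1).doubleFactorial : ℂ)⁻¹) * hirotaTerm τ (n + (2 * j + 1)) g := by
  have h1 : pderiv _ (Sum.inl j : ℕ ⊕ ℕ) (toLaurent (shift (-1) Sum.inl g)) =
      toLaurent (shift (-1) Sum.inl (pderiv ℂ j g)) :=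
    pderiv_toLaurent _ (pderiv_coeff_shift (-1) Sum.inl_injective j · g)
  have hinr : (Sum.inl j : ℕ ⊕ ℕ) ∉ Set.range Sum.inr := by simp
  have h2 : pderiv _ (Sum.inl j) (toLaurent (shift 1 Sum.inr τ)) = 0 := by
    rw [pderiv_toLaurent (g := 0) _ fun n => by
      rw [pderiv_coeff_shift_of_notMem 1 Sum.inr_injective hinr n τ, map_zero]]
    ext1 α
    rw [toLaurent_ext (p := 0) (x := 0) (map_zero _).symm fun n => by simp, map_zero]
  have h3 : pderiv _ (Sum.inl j) (expSeries (phase Sum.inl - phase Sum.inr)) =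
      C (phaseCoeff j) * expSeries (phase Sum.inl - phase Sum.inr) := by
    rw [expSeries, pderiv_subst_exp, map_sub, pderiv_phase Sum.inl_injective,
      pderiv_phase_of_notMem Sum.inr_injective hinr, sub_zero]
    rw [map_sub, constantCoeff_phase, constantCoeff_phase, sub_zero]
  have h4 : C (σ := ℕ ⊕ ℕ) (zPow ((n + (2 * j + 1) : ℕ) : ℤ)) =
      C (zPow n) * C (zPow (2 * j + 1)) := by
    rw [← map_mul, zPow, zPow, zPow, HahnSeries.single_mul_single, mul_one]
    congr 3
    push_cast
    ring
  simp only [hirotaTerm, Derivation.leibniz, smul_eq_mul, pderiv_C, h1, h2, h3, h4, phaseCoeff,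
    map_mul]
  ring

theorem IsTauFunction.residue_hirotaTerm {τ : Fock} (hτ : IsTauFunction τ) (p : ℕ)
    (α : ℕ ⊕ ℕ →₀ ℕ) : (coeff α (hirotaTerm τ (2 * p) τ)).coeff 1 = 0 := by
  have h := hτ p α
  rw [residueAtInfinity, neg_eq_zero] at h
  rw [hirotaTerm]
  push_cast
  exact h

/-- The Hirota identities at `t' = t`: the product `τ(t - [z⁻¹]) τ(t + [z⁻¹])` is even in `z`. -/
theorem IsTauFunction.hirotaCoeff_eq_zero {τ : Fock} (hτ : IsTauFunction τ) (p : ℕ) :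
    hirotaCoeff τ (2 * p) τ = 0 := by
  rw [← diagonalResidue_hirotaTerm]
  exact diagonalResidue_eq_zero (hτ.residue_hirotaTerm p)

/-- The derivative in `t_j` of the Hirota identity with `p = 0`, at `t' = t`. -/
theorem IsTauFunction.hirotaCoeff_pderiv {τ : Fock} (hτ : IsTauFunction τ) (j : ℕ) :
    hirotaCoeff τ 0 (pderiv ℂ j τ) +
      C ((2 * j + 1).doubleFactorial : ℂ)⁻¹ * hirotaCoeff τ (2 * j + 1) τ = 0 := by
  have h := diagonalResidue_eq_zero
    (residue_pderiv_eq_zero (hτ.residue_hirotaTerm 0) (Sum.inl j))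
  rwa [pderiv_hirotaTerm, diagonalResidue_add, diagonalResidue_C_mul, diagonalResidue_hirotaTerm,
    diagonalResidue_hirotaTerm, mul_zero, zero_add] at h

/-! ### The wave operator -/

/-- The power series `g(t - [z⁻¹])` as the symbol of a pseudo-differential operator. -/
def shiftSymbol (g : Fock) : PseudoDiffOp (timeDerivation 0) where
  coeff n := if n ≤ 0 then
    algebraMap Fock FockField (PowerSeries.coeff (-n).toNat (shift (-1) id g)) else 0
  bounded := ⟨0, fun n hn => if_neg (by omega)⟩

theorem coeff_shiftSymbol_neg (g : Fock) (k : ℕ) : (shiftSymbol g).coeff (-k) =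
    algebraMap Fock FockField (PowerSeries.coeff k (shift (-1) id g)) := by
  change (if -(k : ℤ) ≤ 0 then _ else _) = _
  rw [if_pos (by omega), neg_neg, Int.toNat_natCast]

theorem coeff_shiftSymbol_of_pos (g : Fock) (n : ℤ) (hn : 0 < n) :
    (shiftSymbol g).coeff n = 0 := if_neg (by omega)

theorem deriv_shiftSymbol (g : Fock) : PseudoDiffOp.deriv (shiftSymbol g) =
    shiftSymbol (pderiv ℂ 0 g) + PseudoDiffOp.shift 1 (shiftSymbol g) := by
  ext n
  rw [PseudoDiffOp.coeff_deriv, PseudoDiffOp.coeff_add, PseudoDiffOp.coeff_shift]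
  congr 1
  rcases le_or_gt n 0 with hn | hn
  · obtain ⟨k, rfl⟩ : ∃ k : ℕ, n = -k := ⟨(-n).toNat, by omega⟩
    rw [coeff_shiftSymbol_neg, coeff_shiftSymbol_neg, timeDerivation, fractionDerivation_algebraMap,
      ← pderiv_coeff_shift (-1) Function.injective_id, id]
  · rw [coeff_shiftSymbol_of_pos _ _ hn, coeff_shiftSymbol_of_pos _ _ hn, map_zero]

/-- The coefficients of `τ(t + [z⁻¹]) / τ(t)`. -/
def dualWaveCoeff (τ : Fock) (k : ℕ) : FockField :=
  algebraMap Fock FockField (PowerSeries.coeff k (shift 1 id τ)) / algebraMap Fock FockField τ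

theorem residuePairing_shift_shiftSymbol (τ : Fock) (n : ℕ) (g : Fock) :
    PseudoDiffOp.residuePairing (dualWaveCoeff τ) (PseudoDiffOp.shift n (shiftSymbol g)) =
      algebraMap Fock FockField (hirotaCoeff τ n g) / algebraMap Fock FockField τ := by
  have h1 : ∀ m : ℤ, (n : ℤ) < m → (PseudoDiffOp.shift n (shiftSymbol g)).coeff m = 0 :=
    fun m hm => coeff_shiftSymbol_of_pos _ _ (by omega)
  rw [PseudoDiffOp.residuePairing_eq_sum _ h1 (K := n + 2) (by push_cast; omega), hirotaCoeff,
    mul_comm (shift (-1) id g), PowerSeries.coeff_mul,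
    Finset.Nat.sum_antidiagonal_eq_sum_range_succ_mk, map_sum, Finset.sum_div]
  refine Finset.sum_congr rfl fun k hk => ?_
  rw [Finset.mem_range] at hk
  have h2 : (k : ℤ) - 1 - n = -((n + 1 - k : ℕ) : ℤ) := by omega
  rw [PseudoDiffOp.coeff_shift, h2, coeff_shiftSymbol_neg, dualWaveCoeff, map_mul]
  ring

/-- The bilinear identities in terms of symbols. Differentiating the Hirota integrand in `t₀` and
composing its symbol with `∂` have the same effect `g zⁿ ↦ (∂ₓ g) zⁿ + g zⁿ⁺¹` on the first factor,
so the iterated derivatives of both are sums of matching terms. -/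
theorem IsTauFunction.isOrthogonal_shift {τ : Fock} (hτ : IsTauFunction τ) (p : ℕ) :
    PseudoDiffOp.IsOrthogonal (dualWaveCoeff τ)
      (PseudoDiffOp.shift ((2 * p : ℕ) : ℤ) (shiftSymbol τ)) := by
  intro a
  -- Pairs of a combination of Hirota integrands and the corresponding combination of symbols.
  let S : AddSubmonoid (MvPowerSeries (ℕ ⊕ ℕ) (LaurentSeries ℂ) ×
      PseudoDiffOp (timeDerivation 0)) :=
    AddSubmonoid.closure (Set.range fun x : ℕ × Fock =>
      (hirotaTerm τ x.1 x.2, PseudoDiffOp.shift x.1 (shiftSymbol x.2)))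
  have hmem : ∀ n g, (hirotaTerm τ n g, PseudoDiffOp.shift n (shiftSymbol g)) ∈ S :=
    fun n g => AddSubmonoid.subset_closure ⟨(n, g), rfl⟩
  have hderiv : ∀ x ∈ S, (pderiv _ (Sum.inl 0) x.1, PseudoDiffOp.deriv x.2) ∈ S := by
    intro x hx
    induction hx using AddSubmonoid.closure_induction with
    | mem x hx =>
      obtain ⟨⟨n, g⟩, rfl⟩ := hx
      have h := S.add_mem (hmem n (pderiv ℂ 0 g)) (hmem (n + 1) g)
      rw [Prod.mk_add_mk] at h
      convert h using 2
      · rw [pderiv_hirotaTerm]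
        simp
      · rw [PseudoDiffOp.deriv_shift, deriv_shiftSymbol]
        ext m
        simp only [PseudoDiffOp.coeff_shift, PseudoDiffOp.coeff_add]
        congr 2
        push_cast
        ring
    | zero =>
      have h0 : PseudoDiffOp.deriv (0 : PseudoDiffOp (timeDerivation 0)) = 0 := by
        ext m
        simp
      rw [Prod.fst_zero, Prod.snd_zero, map_zero, h0]
      exact S.zero_mem
    | add x y _ _ hx hy =>
      rw [Prod.fst_add, Prod.snd_add, map_add, PseudoDiffOp.deriv_add, ← Prod.mk_add_mk]
      exact S.add_mem hx hy
  have hpair : ∀ x ∈ S, PseudoDiffOp.residuePairing (dualWaveCoeff τ) x.2 =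
      algebraMap Fock FockField (diagonalResidue x.1) / algebraMap Fock FockField τ := by
    intro x hx
    induction hx using AddSubmonoid.closure_induction with
    | mem x hx =>
      obtain ⟨⟨n, g⟩, rfl⟩ := hx
      rw [residuePairing_shift_shiftSymbol, diagonalResidue_hirotaTerm]
    | zero =>
      rw [Prod.fst_zero, Prod.snd_zero, diagonalResidue_eq_zero (fun α => by simp), map_zero,
        zero_div, PseudoDiffOp.residuePairing_eq_top _ (fun _ _ => rfl),
        PseudoDiffOp.coeff_zero, zero_mul]
    | add x y _ _ hx hy =>
      rw [Prod.fst_add, Prod.snd_add, PseudoDiffOp.residuePairing_add, hx, hy,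
        diagonalResidue_add, map_add, add_div]
  have hiter : ∃ Φ, (Φ, PseudoDiffOp.deriv^[a]
      (PseudoDiffOp.shift ((2 * p : ℕ) : ℤ) (shiftSymbol τ))) ∈ S ∧
        ∀ α, (coeff α Φ).coeff 1 = 0 := by
    induction a with
    | zero => exact ⟨_, hmem (2 * p) τ, hτ.residue_hirotaTerm p⟩
    | succ a ih =>
      obtain ⟨Φ, h1, h2⟩ := ih
      refine ⟨_, ?_, residue_pderiv_eq_zero h2 (Sum.inl 0)⟩
      have h3 := hderiv _ h1
      rw [← Function.iterate_succ_apply' PseudoDiffOp.deriv] at h3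
      exact h3
  obtain ⟨Φ, h1, h2⟩ := hiter
  have h3 := hpair (Φ, _) h1
  rw [h3, diagonalResidue_eq_zero h2, map_zero, zero_div]

end KdV

namespace KdV

open MvPowerSeries

instance : CharZero FockField :=
  charZero_of_injective_algebraMap (algebraMap ℂ FockField).injective

theorem algebraMap_ne_zero {τ : Fock} (hτ0 : τ ≠ 0) : algebraMap Fock FockField τ ≠ 0 :=
  (map_ne_zero_iff _ (IsFractionRing.injective Fock FockField)).2 hτ0

/-- The symbol of the wave operator, `ψ(z; t) e^{-ϑ(z; t)} = τ(t - [z⁻¹]) / τ(t)`. -/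
def waveOperator (τ : Fock) : PseudoDiffOp (timeDerivation 0) :=
  (algebraMap Fock FockField τ)⁻¹ • shiftSymbol τ

theorem coeff_waveOperator_zero {τ : Fock} (hτ0 : τ ≠ 0) : (waveOperator τ).coeff 0 = 1 := by
  have h := coeff_shiftSymbol_neg τ 0
  rw [Nat.cast_zero, neg_zero, (coeff_zero_one_shift (-1) τ).1] at h
  rw [waveOperator, PseudoDiffOp.coeff_smul, h, inv_mul_cancel₀ (algebraMap_ne_zero hτ0)]

theorem coeff_waveOperator_of_pos (τ : Fock) (n : ℤ) (hn : 0 < n) :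
    (waveOperator τ).coeff n = 0 := by
  rw [waveOperator, PseudoDiffOp.coeff_smul, coeff_shiftSymbol_of_pos _ _ hn, mul_zero]

theorem coeff_waveOperator_neg_one (τ : Fock) : (waveOperator τ).coeff (-1) = -onePoint τ 0 := by
  have h := coeff_shiftSymbol_neg τ 1
  rw [Nat.cast_one, (coeff_zero_one_shift (-1) τ).2] at h
  rw [waveOperator, PseudoDiffOp.coeff_smul, h, onePoint, timeDerivation,
    fractionDerivation_algebraMap, map_neg, map_one, neg_one_mul, map_neg]
  ring

theorem dualWaveCoeff_zero {τ : Fock} (hτ0 : τ ≠ 0) : dualWaveCoeff τ 0 = 1 := by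
  rw [dualWaveCoeff, (coeff_zero_one_shift 1 τ).1, div_self (algebraMap_ne_zero hτ0)]

theorem shift_smul (n : ℤ) (f : FockField) (A : PseudoDiffOp (timeDerivation 0)) :
    PseudoDiffOp.shift n (f • A) = f • PseudoDiffOp.shift n A := rfl

theorem IsTauFunction.isOrthogonal_waveOperator {τ : Fock} (hτ : IsTauFunction τ) (p : ℕ) :
    PseudoDiffOp.IsOrthogonal (dualWaveCoeff τ)
      (PseudoDiffOp.shift ((2 * p : ℕ) : ℤ) (waveOperator τ)) := by
  rw [waveOperator, shift_smul]
  exact (hτ.isOrthogonal_shift p).smul _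

theorem IsTauFunction.isOrthogonal_waveOperator_zero {τ : Fock} (hτ : IsTauFunction τ) :
    PseudoDiffOp.IsOrthogonal (dualWaveCoeff τ) (waveOperator τ) := by
  have h := hτ.isOrthogonal_waveOperator 0
  have h0 : PseudoDiffOp.shift ((2 * 0 : ℕ) : ℤ) (waveOperator τ) = waveOperator τ := by
    ext n
    simp
  rwa [h0] at h

/-- The linear problem `L ψ = z² ψ`. -/
theorem IsTauFunction.lax_mul {τ : Fock} (hτ : IsTauFunction τ) (hτ0 : τ ≠ 0) :
    lax τ * waveOperator τ = PseudoDiffOp.shift 2 (waveOperator τ) := by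
  have h := hτ.isOrthogonal_waveOperator_zero.schrodinger_mul (dualWaveCoeff_zero hτ0)
    (coeff_waveOperator_zero hτ0) (coeff_waveOperator_of_pos τ) (hτ.isOrthogonal_waveOperator 1)
  have h1 : -2 * timeDerivation 0 ((waveOperator τ).coeff (-1)) = 2 * twoPoint τ 0 0 := by
    rw [coeff_waveOperator_neg_one, map_neg, twoPoint]
    ring
  rwa [h1] at h

theorem twoPoint_eq {τ : Fock} (hτ0 : τ ≠ 0) (i j : ℕ) : twoPoint τ i j =
    algebraMap Fock FockField (pderiv ℂ i (pderiv ℂ j τ) * τ - pderiv ℂ j τ * pderiv ℂ i τ) /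
      algebraMap Fock FockField τ ^ 2 := by
  have h0 := algebraMap_ne_zero hτ0
  have h1 : onePoint τ j * algebraMap Fock FockField τ =
      algebraMap Fock FockField (pderiv ℂ j τ) := by
    rw [onePoint, div_mul_cancel₀ _ h0, timeDerivation, fractionDerivation_algebraMap]
  have h2 := congrArg (timeDerivation i) h1
  rw [Derivation.leibniz, smul_eq_mul, smul_eq_mul] at h2
  simp only [timeDerivation, fractionDerivation_algebraMap] at h2
  have h3 : twoPoint τ i j = fractionDerivation (pderiv ℂ i) (onePoint τ j) := rfl
  rw [eq_div_iff (pow_ne_zero 2 h0), h3, map_sub, map_mul, map_mul, ← h1, ← h2]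
  ring

theorem hirotaCoeff_zero (τ g : Fock) :
    hirotaCoeff τ 0 g = g * pderiv ℂ 0 τ - pderiv ℂ 0 g * τ := by
  rw [hirotaCoeff, zero_add, PowerSeries.coeff_one_mul,
    ← PowerSeries.coeff_zero_eq_constantCoeff_apply,
    ← PowerSeries.coeff_zero_eq_constantCoeff_apply, (coeff_zero_one_shift (-1) g).1,
    (coeff_zero_one_shift (-1) g).2, (coeff_zero_one_shift 1 τ).1, (coeff_zero_one_shift 1 τ).2,
    map_neg, map_one]
  ring

/-- The two-point functions are the coefficients of `ψ ψ* = τ(t - [z⁻¹]) τ(t + [z⁻¹]) / τ²`. -/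
theorem IsTauFunction.hirotaCoeff_eq_twoPoint {τ : Fock} (hτ : IsTauFunction τ) (hτ0 : τ ≠ 0)
    (j : ℕ) : algebraMap Fock FockField (hirotaCoeff τ (2 * j + 1) τ) /
      algebraMap Fock FockField τ ^ 2 =
      ((2 * j + 1).doubleFactorial : FockField) * twoPoint τ 0 j := by
  have hd : ((2 * j + 1).doubleFactorial : ℂ) ≠ 0 :=
    Nat.cast_ne_zero.2 (Nat.doubleFactorial_pos _).ne'
  have h := hτ.hirotaCoeff_pderiv j
  rw [hirotaCoeff_zero] at h
  have h1 : hirotaCoeff τ (2 * j + 1) τ = ((2 * j + 1).doubleFactorial : Fock) *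
      (pderiv ℂ 0 (pderiv ℂ j τ) * τ - pderiv ℂ j τ * pderiv ℂ 0 τ) := by
    have h2 : ((2 * j + 1).doubleFactorial : Fock) * C ((2 * j + 1).doubleFactorial : ℂ)⁻¹ = 1 := by
      rw [← map_natCast (C : ℂ →+* Fock), ← map_mul, mul_inv_cancel₀ hd, map_one]
    linear_combination ((2 * j + 1).doubleFactorial : Fock) * h -
      hirotaCoeff τ (2 * j + 1) τ * h2
  rw [h1, twoPoint_eq hτ0, map_mul, map_natCast, mul_div_assoc]

/-- The residues of the powers of `L^{1/2}` are the coefficients of `ψ ψ*`. -/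
theorem IsTauFunction.residue_npow {τ : Fock} (hτ : IsTauFunction τ) (hτ0 : τ ≠ 0)
    {Q : PseudoDiffOp (timeDerivation 0)} (hQ : PseudoDiffOp.IsSqrt Q (lax τ)) (n : ℕ) :
    (Q.npow n).residue = algebraMap Fock FockField (hirotaCoeff τ n τ) /
      algebraMap Fock FockField τ ^ 2 := by
  rw [← hτ.isOrthogonal_waveOperator_zero.residuePairing_mul (dualWaveCoeff_zero hτ0)
    (coeff_waveOperator_zero hτ0) (coeff_waveOperator_of_pos τ),
    PseudoDiffOp.npow_mul_eq_shift (PseudoDiffOp.sqrt_mul_eq_shift (hτ.lax_mul hτ0) hQ),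
    waveOperator, shift_smul, PseudoDiffOp.residuePairing_smul,
    residuePairing_shift_shiftSymbol]
  ring

/-! ### The product of the wave functions -/

theorem waveFunction_mul_dualWaveFunction (τ : Fock) :
    waveFunction τ * dualWaveFunction τ =
      toWave (toLaurent (shift (-1) id τ * shift 1 id τ)) / timesToWave (τ ^ 2) := by
  have hexp : toWave (expSeries (phase id)) * toWave (expSeries (-phase id)) = 1 := by
    rw [toWave, toWave, ← map_mul, expSeries, expSeries,
      subst_exp_mul_subst_exp_neg (constantCoeff_phase id), map_one]
  have hsq : timesToWave (τ ^ 2) = timesToWave τ * timesToWave τ := by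
    rw [timesToWave, timesToWave, toWave, toWave, sq, map_mul, toLaurent_mul, map_mul]
  have hmul : toWave (toLaurent (shift (-1) id τ * shift 1 id τ)) =
      toWave (toLaurent (shift (-1) id τ)) * toWave (toLaurent (shift 1 id τ)) := by
    rw [toWave, toLaurent_mul, map_mul]
  rw [waveFunction, dualWaveFunction, hsq, hmul, mul_mul_mul_comm, hexp, mul_one,
    div_mul_div_comm]

theorem coeff_twoPointSeries_of_ne (τ : Fock) {n : ℕ} (hn : ∀ j, n ≠ 2 * j + 2) :
    PowerSeries.coeff n (twoPointSeries τ) = 0 := by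
  rw [twoPointSeries, PowerSeries.coeff_mk]
  refine (finsum_congr fun j => ?_).trans finsum_zero
  rw [PowerSeries.coeff_C_mul, PowerSeries.coeff_X_pow, if_neg (hn j), mul_zero]

theorem coeff_twoPointSeries (τ : Fock) (j : ℕ) :
    PowerSeries.coeff (2 * j + 2) (twoPointSeries τ) =
      ((2 * j + 1).doubleFactorial : FockField) * twoPoint τ 0 j := by
  rw [twoPointSeries, PowerSeries.coeff_mk, finsum_eq_single _ j]
  · rw [PowerSeries.coeff_C_mul, PowerSeries.coeff_X_pow, if_pos rfl, mul_one]
  · intro k hk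
    rw [PowerSeries.coeff_C_mul, PowerSeries.coeff_X_pow, if_neg (by omega), mul_zero]

theorem IsTauFunction.one_add_twoPointSeries {τ : Fock} (hτ : IsTauFunction τ) (hτ0 : τ ≠ 0) :
    1 + twoPointSeries τ = PowerSeries.C (algebraMap Fock FockField (τ ^ 2))⁻¹ *
      PowerSeries.map (algebraMap Fock FockField) (shift (-1) id τ * shift 1 id τ) := by
  have h0 := algebraMap_ne_zero hτ0
  ext n
  rw [map_add, PowerSeries.coeff_C_mul, PowerSeries.coeff_map, PowerSeries.coeff_one, map_pow,
    inv_mul_eq_div]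
  obtain rfl | ⟨p, rfl⟩ | ⟨j, rfl⟩ : n = 0 ∨ (∃ p, n = 2 * p + 1) ∨ ∃ j, n = 2 * j + 2 := by
    rcases Nat.even_or_odd' n with ⟨k, rfl | rfl⟩
    · rcases k with _ | k
      · exact Or.inl rfl
      · exact Or.inr (Or.inr ⟨k, rfl⟩)
    · exact Or.inr (Or.inl ⟨k, rfl⟩)
  · rw [coeff_twoPointSeries_of_ne τ (by omega), if_pos rfl, add_zero,
      PowerSeries.coeff_zero_eq_constantCoeff_apply, map_mul,
      ← PowerSeries.coeff_zero_eq_constantCoeff_apply,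
      ← PowerSeries.coeff_zero_eq_constantCoeff_apply, (coeff_zero_one_shift (-1) τ).1,
      (coeff_zero_one_shift 1 τ).1, map_mul, ← sq, div_self (pow_ne_zero 2 h0)]
  · have h1 : PowerSeries.coeff (2 * p + 1) (shift (-1) id τ * shift 1 id τ) = 0 :=
      hτ.hirotaCoeff_eq_zero p
    rw [coeff_twoPointSeries_of_ne τ (by omega), if_neg (by omega), h1, map_zero, zero_div,
      add_zero]
  · rw [coeff_twoPointSeries, if_neg (by omega), zero_add,
      ← hτ.hirotaCoeff_eq_twoPoint hτ0, hirotaCoeff]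

end KdV

end

theorem corollary1p4 (τ : KdV.Fock) (hτ : KdV.IsTauFunction τ) (hτ0 : τ ≠ 0) :
    KdV.EqPowerSeries (KdV.waveFunction τ * KdV.dualWaveFunction τ) (1 + KdV.twoPointSeries τ) ∧
    (∃! Q, PseudoDiffOp.IsSqrt Q (KdV.lax τ)) ∧
    ∀ Q, PseudoDiffOp.IsSqrt Q (KdV.lax τ) → ∀ j : ℕ,
      KdV.twoPoint τ 0 j =
        (Q.npow (2 * j + 1)).residue / ((2 * j + 1).doubleFactorial : KdV.FockField) := by
  refine ⟨⟨τ ^ 2, KdV.shift (-1) id τ * KdV.shift 1 id τ, pow_ne_zero 2 hτ0,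
    KdV.waveFunction_mul_dualWaveFunction τ, hτ.one_add_twoPointSeries hτ0⟩, ?_, ?_⟩
  · exact PseudoDiffOp.existsUnique_sqrt (KdV.coeff_waveOperator_zero hτ0)
      (KdV.coeff_waveOperator_of_pos τ) (hτ.lax_mul hτ0)
  · intro Q hQ j
    rw [hτ.residue_npow hτ0 hQ, hτ.hirotaCoeff_eq_twoPoint hτ0, mul_div_cancel_left₀]
    exact Nat.cast_ne_zero.2 (Nat.doubleFactorial_pos _).ne'
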